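/- Let $r\ge 1$. For $s_1,\dots,s_r\in\mathbb C\setminus\mathbb Z$ put $$\zeta^{\mathrm{des}}_r(s_1,\dots,s_r)=\lim_{c\to1,\;c\in\mathbb R\setminus\{1\}}\frac{1}{(1-c)^r}\prod_{k=1}^r\frac{1}{(e^{2\pi i s_k}-1)\Gamma(s_k)}\int_{\mathcal C^r}\prod_{j=1}^r\Bigl(\frac{1}{e^{t_j+\cdots+t_r}-1}-\frac{c}{e^{c(t_j+\cdots+t_r)}-1}\Bigr)\prod_{k=1}^r t_k^{s_k-1}\,dt_k ,$$ where the removable singularity of $\frac1{e^y-1}-\frac c{e^{cy}-1}$ at $y=0$ is filled in, and $\mathcal C$ is the Hankel contour: from $+\infty$ along the top side of the positive real axis ($\arg t=0$), counterclockwise once around the circle $|t|=\varepsilon$ with $\varepsilon>0$ sufficiently small, and back to $+\infty$ along the bottom side ($\arg t=2\pi$). These integrals converge absolutely for $c\neq 1$ close to $1$, the limit exists and does not depend on small $\varepsilon$, and $\zeta^{\mathrm{des}}_r$ extends to an entire function on $\mathbb C^r$ (the desingularized multiple zeta function), denoted by the same symbol. For $t\in(0,1)$ put $J[f](t)=\int_0^t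 f(z)\,\frac{dz}{z}$, $J^{-1}[f](t)=D[f](t)=t f'(t)$, $$L_0(t)=\frac{t}{1-t}+\frac{t\log t}{(1-t)^2},$$ and, for $\mathbf k=(k_1,\dots,k_r)\in\mathbb Z^r$, $$L^{\mathrm{des}}(\mathbf k)(t)=J^{k_r}\Bigl[L_0\,J^{k_{r-1}}\bigl[L_0\cdots J^{k_1}[L_0]\cdots\bigr]\Bigr](t).$$ Then for every $\mathbf k=(k_1,\dots,k_r)$ with all $k_j\in\mathbb Z_{\le0}$, $$\lim_{t\to1-0}L^{\mathrm{des}}(\mathbf k)(t)=\zeta^{\mathrm{des}}_r(k_1,\dots,k_r).$$ -/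

import Mathlib

open Filter Topology MeasureTheory

noncomputable section

namespace DesMZF

/-! ### The Hankel contour

The contour comes in from `+∞` along the top side of the positive real axis (argument `0`), runs
once counterclockwise around the circle of radius `ε`, and returns to `+∞` along the bottom side
(argument `2π`). It is parametrized by `u : ℝ`: the parameters `u < 0`, `0 ≤ u ≤ 2π` and `2π < u`
give the three pieces. -/

/-- Modulus of the point of the Hankel contour with parameter `u`. -/
def hankelAbs (ε u : ℝ) : ℝ := ε + max (-u) 0 + max (u - 2 * Real.pi) 0

/-- Argument, in `[0, 2π]`, of the point of the Hankel contour with parameter `u`. -/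
def hankelArg (u : ℝ) : ℝ := max 0 (min u (2 * Real.pi))

/-- The point of the Hankel contour with parameter `u`. -/
def hankel (ε u : ℝ) : ℂ := (hankelAbs ε u : ℂ) * Complex.exp (hankelArg u * Complex.I)

/-- The power `t ^ a` at the point `t` of the Hankel contour with parameter `u`, for the branch of
the logarithm that is continuous along the contour. -/
def hankelPow (ε u : ℝ) (a : ℂ) : ℂ :=
  Complex.exp (a * ((Real.log (hankelAbs ε u) : ℂ) + hankelArg u * Complex.I))

/-! ### The desingularized multiple zeta function -/

/-- The function `1 / (e ^ y - 1) - c / (e ^ (c y) - 1)`, with its removable singularity at `y = 0`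
filled in. -/
def kernel (c : ℝ) (y : ℂ) : ℂ :=
  if y = 0 then ((c : ℂ) - 1) / 2
  else 1 / (Complex.exp y - 1) - c / (Complex.exp (c * y) - 1)

/-- The generating function `∏ⱼ kernel c (tⱼ + ⋯ + tᵣ)`. -/
def genFun (r : ℕ) (c : ℝ) (t : Fin r → ℂ) : ℂ :=
  ∏ j : Fin r, kernel c (∑ k ∈ Finset.Ici j, t k)

/-- The factor `∏ₖ 1 / ((e ^ (2πi sₖ) - 1) Γ(sₖ))`. -/
def coeff (r : ℕ) (s : Fin r → ℂ) : ℂ :=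
  ∏ k : Fin r, 1 / ((Complex.exp (2 * Real.pi * Complex.I * s k) - 1) * Complex.Gamma (s k))

/-- The pullback of `genFun r c t * ∏ₖ tₖ ^ (sₖ - 1) dtₖ` under the parametrization of the
`r`-fold product of the Hankel contour. -/
def integrand (r : ℕ) (s : Fin r → ℂ) (ε c : ℝ) (u : Fin r → ℝ) : ℂ :=
  genFun r c (fun k => hankel ε (u k)) *
    ∏ k : Fin r, (hankelPow ε (u k) (s k - 1) * deriv (hankel ε) (u k))

/-- The expression whose limit as `c → 1` is the desingularized multiple zeta function. -/
def preDesZeta (r : ℕ) (s : Fin r → ℂ) (ε c : ℝ) : ℂ :=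
  1 / (1 - (c : ℂ)) ^ r * (coeff r s * ∫ u : Fin r → ℝ, integrand r s ε c u)

/-- `F` is the desingularized multiple zeta function of depth `r`: it is entire on `ℂ ^ r`, and for
non-integral `s₁, …, sᵣ` its value is the limit as `c → 1`, `c ≠ 1`, of the contour integral
expression, whose integrals converge absolutely, for every sufficiently small radius `ε` of the
circle in the Hankel contour. -/
def IsDesZeta (r : ℕ) (F : (Fin r → ℂ) → ℂ) : Prop :=
  Differentiable ℂ F ∧
    ∀ᶠ ε : ℝ in 𝓝[>] 0, ∀ s : Fin r → ℂ, (∀ (j : Fin r) (n : ℤ), s j ≠ n) →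
      (∀ᶠ c : ℝ in 𝓝[≠] 1, Integrable (integrand r s ε c)) ∧
      Tendsto (fun c : ℝ => preDesZeta r s ε c) (𝓝[≠] 1) (𝓝 (F s))

/-- The defining property determines the function. -/
theorem IsDesZeta.unique {r : ℕ} {F G : (Fin r → ℂ) → ℂ} (hF : IsDesZeta r F)
    (hG : IsDesZeta r G) : F = G := by
  have hd : Dense (Set.pi Set.univ fun _ : Fin r => (Set.range ((↑) : ℤ → ℂ))ᶜ) :=
    dense_pi Set.univ fun _ _ => (Set.countable_range _).dense_compl ℝ
  refine Continuous.ext_on hd hF.1.continuous hG.1.continuous fun s hs => ?_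
  have hs' : ∀ (j : Fin r) (n : ℤ), s j ≠ n := fun j n h => hs j (Set.mem_univ j) ⟨n, h.symm⟩
  obtain ⟨ε, h1, h2⟩ := (hF.2.and hG.2).exists
  exact tendsto_nhds_unique (h1 s hs').2 (h2 s hs').2

open Classical in
/-- The desingularized multiple zeta function of depth `r`, as an entire function on `ℂ ^ r`. -/
def desZeta (r : ℕ) : (Fin r → ℂ) → ℂ :=
  if h : ∃ F, IsDesZeta r F then h.choose else 0

/-! ### The functions defined by iterated integrals and derivatives -/

/-- The operator `J[f](t) = ∫₀ᵗ f(z) dz / z`. -/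
def opJ (f : ℝ → ℝ) (t : ℝ) : ℝ := ∫ z in (0 : ℝ)..t, f z / z

/-- The operator `D[f](t) = t f'(t)`, the inverse of `J`. -/
def opD (f : ℝ → ℝ) (t : ℝ) : ℝ := t * deriv f t

/-- The integral powers of the operator `J`, where `J ^ (-1) = D`. -/
def opJPow : ℤ → (ℝ → ℝ) → ℝ → ℝ
  | Int.ofNat n => opJ^[n]
  | Int.negSucc n => opD^[n + 1]

/-- The function `t / (1 - t) + t log t / (1 - t) ^ 2` on `(0, 1)`. -/
def desLiZero (t : ℝ) : ℝ := t / (1 - t) + t * Real.log t / (1 - t) ^ 2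

/-- The function `J ^ kᵣ [L₀ J ^ kᵣ₋₁ [L₀ ⋯ J ^ k₁ [L₀] ⋯ ]]` on `(0, 1)`, where `L₀` is
`desLiZero`. -/
def desLi : (r : ℕ) → (Fin r → ℤ) → ℝ → ℝ
  | 0, _ => fun _ => 1
  | r + 1, k => opJPow (k (Fin.last r)) fun t => desLiZero t * desLi r (Fin.init k) t

end DesMZF

end

/-!
Put `todd y = y / (e ^ y - 1)`. Then `kernel c y = (todd y - todd (c y)) / y`, so as `c → 1` the
quotient `kernel c y / (1 - c)` tends to `todd' y`, here called `desKernel y`, with exponentially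
decaying majorants in a neighbourhood of the positive real axis. By dominated convergence the limit
defining `ζ^des_r(s)` is an iterated Hankel integral of `desKernel`. The coefficient
`1 / ((e ^ (2πis) - 1) Γ(s))` is holomorphic for `re s < 1`. For `0 < re s` the Hankel contour may
be collapsed onto the half-line, where the coefficient becomes `1 / Γ(s)`; hence the integral
continues to an entire function.

At `s = -n` the normalized Hankel integral of `f` is `(-1) ^ n f⁽ⁿ⁾(0)`, by Cauchy's formula. On the
other side, the substitution `t = e ^ (-y)` turns `D = t d/dt` into `-d/dy` and `L₀` into
`desKernel`. So `L^des(k)(e ^ (-y))` and the iterated integral in which every `tⱼ + ⋯ + tᵣ` is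
translated by `y` satisfy the same recursion in `r`, and the claim follows by letting `y → 0`.
-/

noncomputable section

namespace DesMZF

/-! ### Integrals depending holomorphically on a parameter -/

section ParametricIntegral

variable {E G α : Type*} [NormedAddCommGroup E] [NormedSpace ℂ E] [NormedAddCommGroup G]
  [NormedSpace ℂ G] [MeasurableSpace α] {μ : Measure α} {F : E → α → G} {V : Set E} {p : E}

lemma aestronglyMeasurable_fderiv_apply (hV : V ∈ 𝓝 p)
    (hmeas : ∀ q ∈ V, AEStronglyMeasurable (F q) μ) (hd : ∀ a, DifferentiableAt ℂ (F · a) p)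
    (v : E) : AEStronglyMeasurable (fun a => fderiv ℂ (F · a) p v) μ := by
  have hlim : Tendsto (fun n : ℕ => ((n : ℂ) + 1)⁻¹) atTop (𝓝[≠] 0) := by
    refine tendsto_nhdsWithin_iff.2 ⟨?_, Eventually.of_forall fun n => ?_⟩
    · simpa using tendsto_one_div_add_atTop_nhds_zero_nat (𝕜 := ℂ)
    · exact inv_ne_zero (by exact_mod_cast n.succ_ne_zero)
  have hline : Tendsto (fun n : ℕ => p + ((n : ℂ) + 1)⁻¹ • v) atTop (𝓝 p) := by
    simpa using ((hlim.mono_right nhdsWithin_le_nhds).smul_const v).const_add p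
  obtain ⟨N, hN⟩ := eventually_atTop.1 (hline.eventually hV)
  refine aestronglyMeasurable_of_tendsto_ae atTop
    (f := fun n a => (((n + N : ℕ) : ℂ) + 1) • (F (p + (((n + N : ℕ) : ℂ) + 1)⁻¹ • v) a - F p a))
    (fun n => ((hmeas _ (hN _ (Nat.le_add_left _ _))).sub
      (hmeas p (mem_of_mem_nhds hV))).const_smul _) (ae_of_all _ fun a => ?_)
  have hderiv := (hd a).hasFDerivAt.hasLineDerivAt v
  refine ((hasDerivAt_iff_tendsto_slope.1 hderiv).comp
    (hlim.comp (tendsto_add_atTop_nat N))).congr fun n => ?_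
  simp only [Function.comp_apply, slope_def_module, zero_smul, add_zero, sub_zero, inv_inv]

variable [FiniteDimensional ℂ E]

lemma aestronglyMeasurable_fderiv (hV : V ∈ 𝓝 p)
    (hmeas : ∀ q ∈ V, AEStronglyMeasurable (F q) μ) (hd : ∀ a, DifferentiableAt ℂ (F · a) p) :
    AEStronglyMeasurable (fun a => fderiv ℂ (F · a) p) μ := by
  let b := Module.finBasis ℂ E
  let coord i := LinearMap.toContinuousLinearMap (b.coord i)
  have hexpand : (fun a => fderiv ℂ (F · a) p) =
      fun a => ∑ i, (coord i).smulRight (fderiv ℂ (F · a) p (b i)) := by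
    funext a
    refine ContinuousLinearMap.coe_injective (b.ext fun j => ?_)
    simp [coord, Finsupp.single_apply, ite_smul]
  rw [hexpand]
  refine Finset.aestronglyMeasurable_fun_sum _ fun i _ => ?_
  exact (ContinuousLinearMap.smulRightL ℂ E G (coord i)).continuous.comp_aestronglyMeasurable
    (aestronglyMeasurable_fderiv_apply hV hmeas hd (b i))

lemma differentiableAt_integral_of_dominated {bound : α → ℝ} (hV : V ∈ 𝓝 p)
    (hmeas : ∀ q ∈ V, AEStronglyMeasurable (F q) μ) (hd : ∀ a, DifferentiableOn ℂ (F · a) V)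
    (hb : ∀ a, ∀ q ∈ V, ‖F q a‖ ≤ bound a) (hint : Integrable bound μ) :
    DifferentiableAt ℂ (fun q => ∫ a, F q a ∂μ) p := by
  obtain ⟨R, hR, hRV⟩ := Metric.mem_nhds_iff.1 hV
  have hpV := mem_of_mem_nhds hV
  have hsub : ∀ q ∈ Metric.ball p (R / 2), Metric.ball q (R / 2) ⊆ V := fun q hq =>
    (Metric.ball_subset_ball' (by rw [Metric.mem_ball] at hq; linarith)).trans hRV
  refine (hasFDerivAt_integral_of_dominated_of_fderiv_le (F' := fun q a => fderiv ℂ (F · a) q)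
    (bound := fun a => 2 * bound a / (R / 2)) (Metric.ball_mem_nhds p (half_pos hR))
    (mem_of_superset hV hmeas) (hint.mono' (hmeas p hpV) (ae_of_all _ fun a => hb a p hpV))
    (aestronglyMeasurable_fderiv hV hmeas fun a => (hd a).differentiableAt hV)
    (ae_of_all _ fun a q hq => ?_) ((hint.const_mul 2).div_const _)
    (ae_of_all _ fun a q hq => ?_)).differentiableAt
  · -- Cauchy's estimate on the ball of radius `R / 2` around `q`
    refine Complex.norm_fderiv_le_div_of_mapsTo_ball ((hd a).mono (hsub q hq)) (fun z hz => ?_)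
      (half_pos hR)
    rw [Metric.mem_closedBall, dist_eq_norm]
    linarith [norm_sub_le (F z a) (F q a), hb a z (hsub q hq hz),
      hb a q (hsub q hq (Metric.mem_ball_self (half_pos hR)))]
  · exact ((hd a).differentiableAt (mem_of_superset
      (Metric.ball_mem_nhds q (half_pos hR)) (hsub q hq))).hasFDerivAt

end ParametricIntegral

/-! ### The kernel -/

/-- The entire function `(e ^ z - 1) / z`. -/
def expQuot : ℂ → ℂ := dslope Complex.exp 0

/-- The function `z / (e ^ z - 1)` with its removable singularity at `0` filled in, the generating
function of the Bernoulli numbers. -/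
def todd (z : ℂ) : ℂ := (expQuot z)⁻¹

/-- The derivative of `todd`, which is the limit of `kernel c / (1 - c)` as `c → 1`. -/
def desKernel : ℂ → ℂ := deriv todd

/-- The open horizontal strip between the zeros `± 2πi` of `expQuot`. -/
def strip : Set ℂ := {z | |z.im| < 2 * Real.pi}

/-- The open neighbourhood `{z | -ρ < re z, |im z| < ρ}` of the positive real axis. -/
def halfStrip (ρ : ℝ) : Set ℂ := {z | -ρ < z.re ∧ |z.im| < ρ}

/-- The function `f` is bounded by `C * e ^ (-a * re z)` on the half-strip of width `ρ`. -/
def HasExpDecay (a C ρ : ℝ) (f : ℂ → ℂ) : Prop :=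
  ∀ z ∈ halfStrip ρ, ‖f z‖ ≤ C * Real.exp (-a * z.re)

lemma isOpen_strip : IsOpen strip :=
  isOpen_lt (by fun_prop) continuous_const

lemma zero_mem_strip : (0 : ℂ) ∈ strip := by simp [strip, Real.pi_pos]

lemma isOpen_halfStrip (ρ : ℝ) : IsOpen (halfStrip ρ) :=
  (isOpen_lt continuous_const Complex.continuous_re).and
    (isOpen_lt Complex.continuous_im.abs continuous_const)

lemma zero_mem_halfStrip {ρ : ℝ} (hρ : 0 < ρ) : (0 : ℂ) ∈ halfStrip ρ := by
  simp [halfStrip, hρ]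

lemma halfStrip_mono {ρ ρ' : ℝ} (h : ρ ≤ ρ') : halfStrip ρ ⊆ halfStrip ρ' :=
  fun _ hz => ⟨by linarith [hz.1], by linarith [hz.2]⟩

lemma halfStrip_subset_strip {ρ : ℝ} (hρ : ρ ≤ 2) : halfStrip ρ ⊆ strip := fun z hz => by
  change |z.im| < 2 * Real.pi
  linarith [hz.2, Real.pi_gt_three]

lemma real_mul_mem_halfStrip {l : ℝ} (h0 : 0 < l) (h2 : l ≤ 2) {y : ℂ} (hy : y ∈ halfStrip 1) :
    (l : ℂ) * y ∈ halfStrip 2 := by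
  obtain ⟨hre, him⟩ := hy
  simp only [halfStrip, Set.mem_ofPred_eq, Complex.re_ofReal_mul, Complex.im_ofReal_mul, abs_mul,
    abs_of_pos h0]
  constructor <;> nlinarith [abs_nonneg y.im]

lemma differentiable_expQuot : Differentiable ℂ expQuot := by
  rw [← differentiableOn_univ]
  exact (Complex.differentiableOn_dslope univ_mem).2 Complex.differentiable_exp.differentiableOn

lemma mul_expQuot (z : ℂ) : z * expQuot z = Complex.exp z - 1 := by
  simpa [expQuot] using sub_smul_dslope Complex.exp 0 z

lemma expQuot_zero : expQuot 0 = 1 := by simp [expQuot, dslope_same]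

lemma exp_sub_one_ne_zero {z : ℂ} (hz : z ∈ strip) (h0 : z ≠ 0) : Complex.exp z - 1 ≠ 0 := by
  intro h
  obtain ⟨n, rfl⟩ := Complex.exp_eq_one_iff.1 (sub_eq_zero.1 h)
  have hn : n ≠ 0 := by
    rintro rfl
    simp at h0
  have him : |(n : ℝ)| * (2 * Real.pi) < 2 * Real.pi := by
    simpa [strip, abs_mul, abs_of_pos Real.pi_pos] using hz
  have hn' : (1 : ℝ) ≤ |(n : ℝ)| := by exact_mod_cast Int.one_le_abs hn
  nlinarith [Real.two_pi_pos]

lemma expQuot_ne_zero {z : ℂ} (hz : z ∈ strip) : expQuot z ≠ 0 := by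
  rcases eq_or_ne z 0 with rfl | h0
  · simp [expQuot_zero]
  · intro h
    exact exp_sub_one_ne_zero hz h0 (by rw [← mul_expQuot, h, mul_zero])

lemma expQuot_add_mul_deriv (z : ℂ) : expQuot z + z * deriv expQuot z = Complex.exp z := by
  have hprod : HasDerivAt (fun z => z * expQuot z) (1 * expQuot z + z * deriv expQuot z) z :=
    (hasDerivAt_id z).mul (differentiable_expQuot z).hasDerivAt
  have hexp : HasDerivAt (fun z => z * expQuot z) (Complex.exp z) z := by
    simpa only [mul_expQuot] using (Complex.hasDerivAt_exp z).sub_const 1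
  simpa using hprod.unique hexp

lemma deriv_expQuot_zero : deriv expQuot 0 = 1 / 2 := by
  have hd : DifferentiableAt ℂ (deriv expQuot) 0 :=
    (differentiable_expQuot.differentiableOn.deriv isOpen_univ).differentiableAt univ_mem
  have hsum : HasDerivAt (fun z => expQuot z + z * deriv expQuot z)
      (deriv expQuot 0 + (1 * deriv expQuot 0 + 0 * deriv (deriv expQuot) 0)) 0 :=
    (differentiable_expQuot 0).hasDerivAt.add ((hasDerivAt_id (0 : ℂ)).mul hd.hasDerivAt)
  simp only [expQuot_add_mul_deriv] at hsum
  have heq := hsum.unique (Complex.hasDerivAt_exp 0)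
  rw [Complex.exp_zero] at heq
  linear_combination heq / 2

lemma differentiableOn_todd : DifferentiableOn ℂ todd strip :=
  fun z hz => ((differentiable_expQuot z).inv (expQuot_ne_zero hz)).differentiableWithinAt

lemma differentiableAt_todd {z : ℂ} (hz : z ∈ strip) : DifferentiableAt ℂ todd z :=
  differentiableOn_todd.differentiableAt (isOpen_strip.mem_nhds hz)

lemma differentiableOn_desKernel : DifferentiableOn ℂ desKernel strip :=
  differentiableOn_todd.deriv isOpen_strip

lemma measurable_desKernel : Measurable desKernel := measurable_deriv _

lemma todd_of_ne_zero {z : ℂ} (h0 : z ≠ 0) : todd z = z / (Complex.exp z - 1) := by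
  rw [todd, ← mul_expQuot, div_mul_cancel_left₀ h0]

lemma desKernel_zero : desKernel 0 = -1 / 2 := by
  have h := ((differentiable_expQuot 0).hasDerivAt.inv (expQuot_ne_zero zero_mem_strip)).deriv
  rw [deriv_expQuot_zero, expQuot_zero] at h
  exact h.trans (by norm_num)

lemma desKernel_of_ne_zero {z : ℂ} (hz : z ∈ strip) (h0 : z ≠ 0) :
    desKernel z = 1 / (Complex.exp z - 1) - z * Complex.exp z / (Complex.exp z - 1) ^ 2 := by
  have hne := exp_sub_one_ne_zero hz h0
  have hquot : HasDerivAt (fun z => z / (Complex.exp z - 1))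
      ((1 * (Complex.exp z - 1) - z * Complex.exp z) / (Complex.exp z - 1) ^ 2) z :=
    (hasDerivAt_id z).div ((Complex.hasDerivAt_exp z).sub_const 1) hne
  have heq : todd =ᶠ[𝓝 z] fun z => z / (Complex.exp z - 1) := by
    filter_upwards [isOpen_ne.mem_nhds h0] with w hw using todd_of_ne_zero hw
  rw [desKernel, heq.deriv_eq, hquot.deriv]
  field_simp

lemma half_exp_re_le_norm_exp_sub_one {z : ℂ} (hz : 1 ≤ z.re) :
    Real.exp z.re / 2 ≤ ‖Complex.exp z - 1‖ := by
  have h := norm_sub_norm_le (Complex.exp z) 1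
  rw [Complex.norm_exp, norm_one] at h
  linarith [Real.add_one_le_exp z.re]

lemma norm_desKernel_le_of_one_le_re {z : ℂ} (hz : z ∈ halfStrip 2) (hre : 1 ≤ z.re) :
    ‖desKernel z‖ ≤ 10 * Real.exp (-(1 / 2) * z.re) := by
  have h0 : z ≠ 0 := fun h => by norm_num [h] at hre
  have hden := half_exp_re_le_norm_exp_sub_one hre
  have hnorm : ‖z‖ ≤ 2 * Real.exp (z.re / 2) := by
    linarith [Complex.norm_le_abs_re_add_abs_im z, abs_of_pos (one_pos.trans_le hre), hz.2,
      Real.add_one_le_exp (z.re / 2)]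
  have hE1 : 1 ≤ Real.exp (z.re / 2) := Real.one_le_exp (by linarith)
  have hsq : Real.exp z.re = Real.exp (z.re / 2) ^ 2 := by rw [← Real.exp_nat_mul]; ring_nf
  have hinv : Real.exp (-(1 / 2) * z.re) = (Real.exp (z.re / 2))⁻¹ := by
    rw [← Real.exp_neg]; ring_nf
  rw [desKernel_of_ne_zero (halfStrip_subset_strip le_rfl hz) h0]
  have hfst : ‖1 / (Complex.exp z - 1)‖ ≤ 2 * (Real.exp (z.re / 2))⁻¹ := by
    rw [norm_div, norm_one]
    calc 1 / ‖Complex.exp z - 1‖ ≤ 1 / (Real.exp z.re / 2) := by gcongr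
      _ = 2 * ((Real.exp (z.re / 2))⁻¹ * (Real.exp (z.re / 2))⁻¹) := by rw [hsq]; field_simp
      _ ≤ 2 * (1 * (Real.exp (z.re / 2))⁻¹) := by gcongr; exact inv_le_one_of_one_le₀ hE1
      _ = _ := by rw [one_mul]
  have hsnd : ‖z * Complex.exp z / (Complex.exp z - 1) ^ 2‖ ≤ 8 * (Real.exp (z.re / 2))⁻¹ := by
    rw [norm_div, norm_mul, norm_pow, Complex.norm_exp]
    calc ‖z‖ * Real.exp z.re / ‖Complex.exp z - 1‖ ^ 2
        ≤ 2 * Real.exp (z.re / 2) * Real.exp z.re / (Real.exp z.re / 2) ^ 2 := by gcongr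
      _ = 8 * (Real.exp (z.re / 2))⁻¹ := by rw [hsq]; field_simp; norm_num
  rw [hinv]
  linarith [norm_sub_le (1 / (Complex.exp z - 1)) (z * Complex.exp z / (Complex.exp z - 1) ^ 2)]

lemma exists_hasExpDecay_desKernel : ∃ C, HasExpDecay (1 / 2) C 2 desKernel := by
  have hsub : (Set.Icc (-2 : ℝ) 1 ×ℂ Set.Icc (-2 : ℝ) 2) ⊆ strip := fun z hz => by
    change |z.im| < 2 * Real.pi
    linarith [abs_le.2 hz.2, Real.pi_gt_three]
  obtain ⟨M, hM⟩ := (isCompact_Icc.reProdIm isCompact_Icc).exists_bound_of_continuousOn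
    (differentiableOn_desKernel.continuousOn.mono hsub)
  refine ⟨max (M * Real.exp 1) 10, fun z hz => ?_⟩
  rcases le_total z.re 1 with hre | hre
  · have hbound := hM z ⟨⟨hz.1.le, hre⟩, abs_le.1 hz.2.le⟩
    calc ‖desKernel z‖ ≤ M * 1 := by rwa [mul_one]
      _ ≤ M * Real.exp (1 + -(1 / 2) * z.re) := by
        gcongr
        · exact (norm_nonneg _).trans hbound
        · exact Real.one_le_exp (by linarith)
      _ = M * Real.exp 1 * Real.exp (-(1 / 2) * z.re) := by rw [Real.exp_add, mul_assoc]
      _ ≤ _ := by gcongr; exact le_max_left _ _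
  · exact (norm_desKernel_le_of_one_le_re hz hre).trans (by gcongr; exact le_max_right _ _)

lemma HasExpDecay.nonneg {a C ρ : ℝ} {f : ℂ → ℂ} (hf : HasExpDecay a C ρ f) (hρ : 0 < ρ) :
    0 ≤ C := by
  simpa using (norm_nonneg _).trans (hf 0 (zero_mem_halfStrip hρ))

lemma HasExpDecay.mono {a C ρ ρ' : ℝ} {f : ℂ → ℂ} (hf : HasExpDecay a C ρ f) (h : ρ' ≤ ρ) :
    HasExpDecay a C ρ' f :=
  fun z hz => hf z (halfStrip_mono h hz)

lemma kernel_zero (c : ℝ) : kernel c 0 = (c - 1) / 2 := if_pos rfl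

lemma kernel_eq_todd_sub {c : ℝ} (hc : c ≠ 0) {y : ℂ} (h0 : y ≠ 0) :
    kernel c y = (todd y - todd (c * y)) / y := by
  have hc' : (c : ℂ) ≠ 0 := by exact_mod_cast hc
  rw [kernel, if_neg h0, todd_of_ne_zero h0, todd_of_ne_zero (mul_ne_zero hc' h0)]
  field_simp

lemma measurable_kernel (c : ℝ) : Measurable (kernel c) :=
  Measurable.ite (measurableSet_singleton 0) measurable_const (by fun_prop)

lemma kernel_zero_div {c : ℝ} (hc : c ≠ 1) : kernel c 0 / (1 - c) = -1 / 2 := by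
  have hc' : (1 - (c : ℂ)) ≠ 0 := sub_ne_zero.2 (by exact_mod_cast hc.symm)
  rw [kernel_zero]
  field_simp
  ring

lemma norm_todd_sub_todd_mul_le {C c : ℝ} (hb : HasExpDecay (1 / 2) C 2 desKernel)
    (hc : c ∈ Set.Icc (1 / 2 : ℝ) 2) {y : ℂ} (hy : y ∈ halfStrip 1) :
    ‖todd y - todd (c * y)‖ ≤ C * Real.exp (1 - y.re / 4) * ‖y - c * y‖ := by
  have hC := hb.nonneg two_pos
  have hseg : ∀ z ∈ segment ℝ ((c : ℂ) * y) y, ∃ l ∈ Set.Icc (1 / 2 : ℝ) 2, z = l * y := by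
    rintro _ ⟨a, b, ha, hb, hab, rfl⟩
    refine ⟨a * c + b, ⟨by nlinarith [hc.1], by nlinarith [hc.2]⟩, ?_⟩
    simp only [Complex.real_smul]
    push_cast
    ring
  refine (convex_segment ((c : ℂ) * y) y).norm_image_sub_le_of_norm_deriv_le (𝕜 := ℂ)
    (fun z hz => ?_) (fun z hz => ?_) (left_mem_segment _ _ _) (right_mem_segment _ _ _) <;>
    obtain ⟨l, ⟨hl, hl'⟩, rfl⟩ := hseg z hz <;>
    have hmem := real_mul_mem_halfStrip (by linarith) hl' hy
  · exact differentiableAt_todd (halfStrip_subset_strip le_rfl hmem)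
  · refine (hb _ hmem).trans ?_
    rw [Complex.re_ofReal_mul]
    gcongr
    rcases le_total y.re 0 with _ | _ <;> nlinarith [hy.1]

lemma exists_hasExpDecay_kernel_div :
    ∃ C, ∀ c ∈ Set.Ioo (1 / 2 : ℝ) 2, c ≠ 1 →
      HasExpDecay (1 / 4) C 1 fun y => kernel c y / (1 - c) := by
  obtain ⟨C, hb⟩ := exists_hasExpDecay_desKernel
  have hC := hb.nonneg two_pos
  refine ⟨C * Real.exp 1 + 1, fun c hc hc1 y hy => ?_⟩
  rcases eq_or_ne y 0 with rfl | h0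
  · beta_reduce
    rw [kernel_zero_div hc1]
    norm_num
    nlinarith [Real.exp_pos 1]
  have hc1' : (1 - (c : ℂ)) ≠ 0 := sub_ne_zero.2 (by exact_mod_cast hc1.symm)
  have hmvt := norm_todd_sub_todd_mul_le hb ⟨hc.1.le, hc.2.le⟩ hy
  rw [show y - c * y = (1 - c) * y by ring, norm_mul] at hmvt
  calc ‖kernel c y / (1 - c)‖
      = ‖todd y - todd (c * y)‖ / (‖1 - (c : ℂ)‖ * ‖y‖) := by
        rw [kernel_eq_todd_sub (by linarith [hc.1]) h0, norm_div, norm_div, div_div,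
          mul_comm ‖y‖]
    _ ≤ C * Real.exp (1 - y.re / 4) := (div_le_iff₀ (by positivity)).2 hmvt
    _ = C * Real.exp 1 * Real.exp (-(1 / 4) * y.re) := by
        rw [mul_assoc, ← Real.exp_add]
        ring_nf
    _ ≤ (C * Real.exp 1 + 1) * Real.exp (-(1 / 4) * y.re) := by
        gcongr
        linarith

lemma hasDerivAt_todd_mul {y : ℂ} (hy : y ∈ strip) :
    HasDerivAt (fun c : ℝ => todd (c * y)) (desKernel y * y) 1 := by
  have htodd : HasDerivAt todd (desKernel y) (((1 : ℝ) : ℂ) * y) := by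
    rw [Complex.ofReal_one, one_mul]
    exact (differentiableAt_todd hy).hasDerivAt
  have hmul : HasDerivAt (fun c : ℝ => (c : ℂ) * y) y 1 := by
    simpa using (Complex.ofRealCLM.hasDerivAt (x := 1)).mul_const y
  exact HasDerivAt.comp (h₂ := todd) (1 : ℝ) htodd hmul

lemma tendsto_kernel_div {y : ℂ} (hy : y ∈ strip) :
    Tendsto (fun c : ℝ => kernel c y / (1 - c)) (𝓝[≠] 1) (𝓝 (desKernel y)) := by
  rcases eq_or_ne y 0 with rfl | h0
  · rw [desKernel_zero]
    refine tendsto_const_nhds.congr' ?_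
    filter_upwards [self_mem_nhdsWithin] with c hc using (kernel_zero_div hc).symm
  have hslope := (hasDerivAt_iff_tendsto_slope.1 (hasDerivAt_todd_mul hy)).div_const y
  rw [mul_div_cancel_right₀ _ h0] at hslope
  refine hslope.congr' ?_
  filter_upwards [self_mem_nhdsWithin, nhdsWithin_le_nhds (lt_mem_nhds (one_pos (α := ℝ)))]
    with c hc hc0
  have hc1 : (1 - (c : ℂ)) ≠ 0 := sub_ne_zero.2 (by exact_mod_cast Ne.symm hc)
  have hc1' : ((c : ℂ) - 1) ≠ 0 := sub_ne_zero.2 (by exact_mod_cast hc)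
  rw [kernel_eq_todd_sub hc0.ne' h0, slope_def_module, Complex.ofReal_one, one_mul,
    Complex.real_smul]
  push_cast
  field_simp
  ring

/-! ### Contours and iterated integrals -/

/-- The closed neighbourhood `{z | -δ ≤ re z, |im z| ≤ δ}` of the positive real axis. -/
def closedHalfStrip (δ : ℝ) : Set ℂ := {z | -δ ≤ z.re ∧ |z.im| ≤ δ}

/-- A function that may be integrated along contours in `closedHalfStrip δ` for `δ < ρ`: it is
holomorphic on the half-strip of width `ρ` and decays exponentially there. The rate `1 / 4` is the
one that `kernel c` attains uniformly in `1 / 2 < c < 2`. -/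
structure IsTestFunction (ρ : ℝ) (f : ℂ → ℂ) : Prop where
  differentiableOn : DifferentiableOn ℂ f (halfStrip ρ)
  exists_hasExpDecay : ∃ C, HasExpDecay (1 / 4) C ρ f

/-- A path in the complex plane together with a weight. The weight comprises the derivative of the
path and the multivalued factor `t ^ (s - 1)`, which is not a function on the plane. -/
structure WeightedPath where
  /-- The point of the plane with a given parameter. -/
  path : ℝ → ℂ
  /-- The weight at a given parameter. -/
  weight : ℝ → ℂ

namespace WeightedPath

/-- The integrand of `WeightedPath.integral`. -/
def pullback (γ : WeightedPath) (f : ℂ → ℂ) (u : ℝ) : ℂ := γ.weight u * f (γ.path u)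

/-- The integral of a function along a weighted path. -/
def integral (γ : WeightedPath) (f : ℂ → ℂ) : ℂ := ∫ u, γ.pullback f u

/-- Scalars multiply the weight. -/
instance : SMul ℂ WeightedPath := ⟨fun a γ => ⟨γ.path, fun u => a * γ.weight u⟩⟩

@[simp] lemma path_smul (a : ℂ) (γ : WeightedPath) : (a • γ).path = γ.path := rfl

@[simp] lemma weight_smul (a : ℂ) (γ : WeightedPath) (u : ℝ) :
    (a • γ).weight u = a * γ.weight u := rfl

lemma integral_smul (a : ℂ) (γ : WeightedPath) (f : ℂ → ℂ) :
    (a • γ).integral f = a * γ.integral f := by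
  simp only [integral, pullback, path_smul, weight_smul, mul_assoc, integral_const_mul]

end WeightedPath

/-- A weighted path in `closedHalfStrip δ` along which test functions are integrable. -/
structure IsContour (δ : ℝ) (γ : WeightedPath) : Prop where
  measurable_path : Measurable γ.path
  measurable_weight : Measurable γ.weight
  path_mem : ∀ u, γ.path u ∈ closedHalfStrip δ
  integrable : Integrable fun u => ‖γ.weight u‖ * Real.exp (-(1 / 4) * (γ.path u).re)

/-- A family of weighted paths with a common path whose weights depend holomorphically on a
parameter in `D` and are locally uniformly dominated. -/
structure IsContourFamily (δ : ℝ) (γ : ℂ → WeightedPath) (D : Set ℂ) : Prop where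
  path_eq : ∀ s t, (γ s).path = (γ t).path
  measurable_path : ∀ s, Measurable (γ s).path
  measurable_weight : ∀ s, Measurable (γ s).weight
  path_mem : ∀ s u, (γ s).path u ∈ closedHalfStrip δ
  differentiableOn : ∀ u, DifferentiableOn ℂ (fun s => (γ s).weight u) D
  dominated : ∀ s ∈ D, ∃ V ∈ 𝓝 s, ∃ B : ℝ → ℝ, (∀ q ∈ V, ∀ u, ‖(γ q).weight u‖ ≤ B u) ∧
    Integrable fun u => B u * Real.exp (-(1 / 4) * ((γ s).path u).re)

/-- Two weighted paths are equivalent if test functions have the same integral along both. -/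
def ContourEquiv (δ : ℝ) (γ γ' : WeightedPath) : Prop :=
  ∀ ρ f, δ < ρ → IsTestFunction ρ f → γ.integral f = γ'.integral f

lemma ContourEquiv.refl (δ : ℝ) (γ : WeightedPath) : ContourEquiv δ γ γ :=
  fun _ _ _ _ => rfl

lemma ContourEquiv.symm {δ : ℝ} {γ γ' : WeightedPath} (h : ContourEquiv δ γ γ') :
    ContourEquiv δ γ' γ :=
  fun ρ f hρ hf => (h ρ f hρ hf).symm

lemma closedHalfStrip_mono {δ δ' : ℝ} (h : δ ≤ δ') : closedHalfStrip δ ⊆ closedHalfStrip δ' :=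
  fun _ hz => ⟨by linarith [hz.1], hz.2.trans h⟩

lemma closedHalfStrip_subset_halfStrip {δ ρ : ℝ} (h : δ < ρ) :
    closedHalfStrip δ ⊆ halfStrip ρ :=
  fun _ hz => ⟨by linarith [hz.1], by linarith [hz.2]⟩

lemma add_mem_halfStrip {δ ρ : ℝ} {y z : ℂ} (hy : y ∈ halfStrip ρ) (hz : z ∈ closedHalfStrip δ) :
    y + z ∈ halfStrip (ρ + δ) := by
  refine ⟨?_, ?_⟩
  · rw [Complex.add_re]
    linarith [hy.1, hz.1]
  · rw [Complex.add_im]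
    linarith [abs_add_le y.im z.im, hy.2, hz.2]

lemma exists_mem_halfStrip_of_mem {ρ : ℝ} {y : ℂ} (hy : y ∈ halfStrip ρ) :
    ∃ ρ' < ρ, y ∈ halfStrip ρ' := by
  obtain ⟨ρ', h, h'⟩ := exists_between (max_lt (neg_lt.1 hy.1) hy.2)
  exact ⟨ρ', h', by linarith [(max_lt_iff.1 h).1], (max_lt_iff.1 h).2⟩

lemma IsTestFunction.mono {ρ ρ' : ℝ} {f : ℂ → ℂ} (hf : IsTestFunction ρ f) (h : ρ' ≤ ρ) :
    IsTestFunction ρ' f :=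
  ⟨hf.differentiableOn.mono (halfStrip_mono h), hf.exists_hasExpDecay.imp fun _ hC => hC.mono h⟩

lemma IsTestFunction.exists_comp_const_add {δ ρ : ℝ} {f : ℂ → ℂ}
    (hf : IsTestFunction (ρ + δ) f) {y : ℂ} (hy : y ∈ halfStrip ρ) :
    ∃ ρ', δ < ρ' ∧ IsTestFunction ρ' fun z => f (y + z) := by
  obtain ⟨σ, hσ, hy⟩ := exists_mem_halfStrip_of_mem hy
  have hmem : ∀ z ∈ halfStrip (ρ + δ - σ), y + z ∈ halfStrip (ρ + δ) := fun z hz =>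
    halfStrip_mono (by linarith) (add_mem_halfStrip hy ⟨hz.1.le, hz.2.le⟩)
  obtain ⟨C, hC⟩ := hf.exists_hasExpDecay
  refine ⟨ρ + δ - σ, by linarith, hf.differentiableOn.comp (by fun_prop) hmem,
    C * Real.exp (-(1 / 4) * y.re), fun z hz => (hC _ (hmem z hz)).trans_eq ?_⟩
  rw [mul_assoc, ← Real.exp_add, ← mul_add, Complex.add_re]

lemma IsContour.nonneg {δ : ℝ} {γ : WeightedPath} (hγ : IsContour δ γ) : 0 ≤ δ :=
  (abs_nonneg _).trans (hγ.path_mem 0).2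

lemma IsContour.integrable_pullback {δ ρ : ℝ} {γ : WeightedPath} (hγ : IsContour δ γ)
    (hρ : δ < ρ) {f : ℂ → ℂ} (hf : IsTestFunction ρ f) : Integrable (γ.pullback f) := by
  classical
  obtain ⟨C, hC⟩ := hf.exists_hasExpDecay
  have hmem : ∀ u, γ.path u ∈ halfStrip ρ := fun u =>
    closedHalfStrip_subset_halfStrip hρ (hγ.path_mem u)
  have hmeas : Measurable fun u => f (γ.path u) := by
    convert (hf.differentiableOn.continuousOn.measurable_piecewise continuousOn_const
      (isOpen_halfStrip ρ).measurableSet (g := fun _ => 0)).comp hγ.measurable_path using 1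
    funext u
    simp [Set.piecewise, hmem u]
  refine (hγ.integrable.const_mul C).mono' (hγ.measurable_weight.mul hmeas).aestronglyMeasurable
    (ae_of_all _ fun u => ?_)
  calc ‖γ.weight u * f (γ.path u)‖
      ≤ ‖γ.weight u‖ * (C * Real.exp (-(1 / 4) * (γ.path u).re)) := by
        rw [norm_mul]
        gcongr
        exact hC _ (hmem u)
    _ = C * (‖γ.weight u‖ * Real.exp (-(1 / 4) * (γ.path u).re)) := mul_left_comm _ _ _

lemma IsContour.smul {δ : ℝ} {γ : WeightedPath} (hγ : IsContour δ γ) (a : ℂ) :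
    IsContour δ (a • γ) where
  measurable_path := hγ.measurable_path
  measurable_weight := hγ.measurable_weight.const_mul a
  path_mem := hγ.path_mem
  integrable := by
    simpa only [WeightedPath.path_smul, WeightedPath.weight_smul, norm_mul, mul_assoc] using
      hγ.integrable.const_mul ‖a‖

lemma IsContourFamily.isContour {δ : ℝ} {γ : ℂ → WeightedPath} {D : Set ℂ}
    (h : IsContourFamily δ γ D) {s : ℂ} (hs : s ∈ D) : IsContour δ (γ s) where
  measurable_path := h.measurable_path s
  measurable_weight := h.measurable_weight s
  path_mem := h.path_mem s
  integrable := by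
    obtain ⟨V, hV, B, hB, hint⟩ := h.dominated s hs
    have hp := h.measurable_path s
    have hw := h.measurable_weight s
    refine hint.mono' (by fun_prop) (ae_of_all _ fun u => ?_)
    rw [Real.norm_of_nonneg (by positivity)]
    gcongr
    exact hB s (mem_of_mem_nhds hV) u

lemma IsContourFamily.smul {δ : ℝ} {γ : ℂ → WeightedPath} {D D' : Set ℂ}
    (h : IsContourFamily δ γ D) {κ : ℂ → ℂ} (hD' : IsOpen D') (hsub : D' ⊆ D)
    (hκ : DifferentiableOn ℂ κ D') : IsContourFamily δ (fun s => κ s • γ s) D' where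
  path_eq := h.path_eq
  measurable_path := h.measurable_path
  measurable_weight s := (h.measurable_weight s).const_mul _
  path_mem := h.path_mem
  differentiableOn u := hκ.mul ((h.differentiableOn u).mono hsub)
  dominated s hs := by
    obtain ⟨V, hV, B, hB, hint⟩ := h.dominated s (hsub hs)
    have hbdd : ∀ᶠ q in 𝓝 s, ‖κ q‖ < ‖κ s‖ + 1 :=
      ((hκ.continuousOn.continuousAt (hD'.mem_nhds hs)).norm).eventually_lt_const (by linarith)
    refine ⟨_, inter_mem hV hbdd, fun u => (‖κ s‖ + 1) * B u, fun q hq u => ?_, ?_⟩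
    · rw [WeightedPath.weight_smul, norm_mul]
      exact mul_le_mul hq.2.le (hB q hq.1 u) (norm_nonneg _) (by positivity)
    · simpa only [WeightedPath.path_smul, mul_assoc] using hint.const_mul (‖κ s‖ + 1)

/-- The integrand of `iterInt`. -/
def iterIntegrand {r : ℕ} (g : ℂ → ℂ) (γ : Fin r → WeightedPath) (y : ℂ) (u : Fin r → ℝ) : ℂ :=
  (∏ j, g (y + ∑ k ∈ Finset.Ici j, (γ k).path (u k))) * ∏ k, (γ k).weight (u k)

/-- The integral of `∏ⱼ g (y + tⱼ + ⋯ + tᵣ)` along a product of weighted paths. The translation `y`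
makes room for induction on `r`, see `iterInt_succ`. -/
def iterInt {r : ℕ} (g : ℂ → ℂ) (γ : Fin r → WeightedPath) (y : ℂ) : ℂ :=
  ∫ u : Fin r → ℝ, iterIntegrand g γ y u

lemma tail_sum_mem_closedHalfStrip {r : ℕ} {δ : ℝ} {z : Fin r → ℂ}
    (hz : ∀ k, z k ∈ closedHalfStrip δ) (j : Fin r) :
    ∑ k ∈ Finset.Ici j, z k ∈ closedHalfStrip (r * δ) ∧
      (z j).re - r * δ ≤ (∑ k ∈ Finset.Ici j, z k).re := by
  have hδ : 0 ≤ δ := (abs_nonneg _).trans (hz j).2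
  have hcard : ((Finset.Ici j).card : ℝ) * δ ≤ r * δ := by
    gcongr
    simp
  have hre : (z j).re + δ ≤ ∑ k ∈ Finset.Ici j, ((z k).re + δ) :=
    Finset.single_le_sum (f := fun k => (z k).re + δ) (fun k _ => by linarith [(hz k).1])
      (Finset.mem_Ici.2 le_rfl)
  rw [Finset.sum_add_distrib, Finset.sum_const, nsmul_eq_mul] at hre
  have him : |∑ k ∈ Finset.Ici j, (z k).im| ≤ (Finset.Ici j).card * δ := by
    refine (Finset.abs_sum_le_sum_abs _ _).trans ?_
    rw [← nsmul_eq_mul, ← Finset.sum_const]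
    exact Finset.sum_le_sum fun k _ => (hz k).2
  refine ⟨⟨?_, ?_⟩, ?_⟩
  · rw [Complex.re_sum]
    linarith [(hz j).1]
  · rw [Complex.im_sum]
    linarith
  · rw [Complex.re_sum]
    linarith

section IterInt

variable {r : ℕ} {g : ℂ → ℂ} {γ γ' : Fin r → WeightedPath} {δ ρ C : ℝ} {y : ℂ}

lemma measurable_iterIntegrand (hg : Measurable g) (hp : ∀ k, Measurable (γ k).path)
    (hw : ∀ k, Measurable (γ k).weight) (y : ℂ) : Measurable (iterIntegrand g γ y) := by
  unfold iterIntegrand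
  fun_prop

lemma add_tail_sum_mem_halfStrip (hρ : ρ + r * δ ≤ 1) (hy : y ∈ halfStrip ρ) {z : Fin r → ℂ}
    (hz : ∀ k, z k ∈ closedHalfStrip δ) (j : Fin r) :
    y + ∑ k ∈ Finset.Ici j, z k ∈ halfStrip 1 :=
  halfStrip_mono hρ (add_mem_halfStrip hy (tail_sum_mem_closedHalfStrip hz j).1)

lemma norm_iterIntegrand_le (hρ : ρ + r * δ ≤ 1) (hg : HasExpDecay (1 / 4) C 1 g)
    (hγ : ∀ k u, (γ k).path u ∈ closedHalfStrip δ) (hy : y ∈ halfStrip ρ) (u : Fin r → ℝ) :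
    ‖iterIntegrand g γ y u‖ ≤ ∏ k, C * Real.exp (1 / 4) *
      (‖(γ k).weight (u k)‖ * Real.exp (-(1 / 4) * ((γ k).path (u k)).re)) := by
  have hC := hg.nonneg one_pos
  rw [iterIntegrand, norm_mul, norm_prod, norm_prod, ← Finset.prod_mul_distrib]
  refine Finset.prod_le_prod (fun _ _ => by positivity) fun j _ => ?_
  have hz := fun k => hγ k (u k)
  calc ‖g (y + ∑ k ∈ Finset.Ici j, (γ k).path (u k))‖ * ‖(γ j).weight (u j)‖
      ≤ C * Real.exp (1 / 4 + -(1 / 4) * ((γ j).path (u j)).re) * ‖(γ j).weight (u j)‖ := by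
        gcongr
        refine (hg _ (add_tail_sum_mem_halfStrip hρ hy hz j)).trans ?_
        gcongr
        rw [Complex.add_re]
        linarith [(tail_sum_mem_closedHalfStrip hz j).2, hy.1]
    _ = _ := by
        rw [Real.exp_add]
        ring

lemma integrable_iterIntegrand_majorant (C : ℝ) (hγ : ∀ k, IsContour δ (γ k)) :
    Integrable fun u : Fin r → ℝ => ∏ k, C * Real.exp (1 / 4) *
      (‖(γ k).weight (u k)‖ * Real.exp (-(1 / 4) * ((γ k).path (u k)).re)) :=
  Integrable.fintype_prod (f := fun k x => C * Real.exp (1 / 4) *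
    (‖(γ k).weight x‖ * Real.exp (-(1 / 4) * ((γ k).path x).re)))
    fun k => (hγ k).integrable.const_mul _

lemma integrable_iterIntegrand (hρ : ρ + r * δ ≤ 1) (hg : Measurable g)
    (hdecay : HasExpDecay (1 / 4) C 1 g) (hγ : ∀ k, IsContour δ (γ k)) (hy : y ∈ halfStrip ρ) :
    Integrable (iterIntegrand g γ y) :=
  (integrable_iterIntegrand_majorant C hγ).mono'
    (measurable_iterIntegrand hg (fun k => (hγ k).measurable_path)
      (fun k => (hγ k).measurable_weight) y).aestronglyMeasurable
    (ae_of_all _ fun u => norm_iterIntegrand_le hρ hdecay (fun k => (hγ k).path_mem) hy u)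

lemma exists_norm_iterInt_le (hρ : ρ + r * δ ≤ 1) (hg : IsTestFunction 1 g)
    (hγ : ∀ k, IsContour δ (γ k)) : ∃ M, ∀ y ∈ halfStrip ρ, ‖iterInt g γ y‖ ≤ M := by
  obtain ⟨C, hC⟩ := hg.exists_hasExpDecay
  exact ⟨_, fun y hy => norm_integral_le_of_norm_le (integrable_iterIntegrand_majorant C hγ)
    (ae_of_all _ fun u => norm_iterIntegrand_le hρ hC (fun k => (hγ k).path_mem) hy u)⟩

lemma differentiableOn_iterInt (hρ : ρ + r * δ ≤ 1) (hgm : Measurable g)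
    (hg : IsTestFunction 1 g) (hγ : ∀ k, IsContour δ (γ k)) :
    DifferentiableOn ℂ (iterInt g γ) (halfStrip ρ) := by
  obtain ⟨C, hC⟩ := hg.exists_hasExpDecay
  intro y hy
  refine (differentiableAt_integral_of_dominated ((isOpen_halfStrip ρ).mem_nhds hy)
    (fun q _ => (measurable_iterIntegrand hgm (fun k => (hγ k).measurable_path)
      (fun k => (hγ k).measurable_weight) q).aestronglyMeasurable) (fun u => ?_)
    (fun u q hq => norm_iterIntegrand_le hρ hC (fun k => (hγ k).path_mem) hq u)
    (integrable_iterIntegrand_majorant C hγ)).differentiableWithinAt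
  refine DifferentiableOn.mul (DifferentiableOn.fun_finsetProd fun j _ => ?_)
    (differentiableOn_const _)
  exact hg.differentiableOn.comp (differentiableOn_id.add_const _) fun q hq =>
    add_tail_sum_mem_halfStrip hρ hq (fun k => (hγ k).path_mem (u k)) j

lemma IsTestFunction.mul_iterInt (hρ : ρ + r * δ ≤ 1) (hgm : Measurable g)
    (hg : IsTestFunction 1 g) (hγ : ∀ k, IsContour δ (γ k)) :
    IsTestFunction ρ fun z => g z * iterInt g γ z := by
  have hrδ : 0 ≤ r * δ := by
    simpa using Finset.sum_nonneg fun k (_ : k ∈ Finset.univ) => (hγ k).nonneg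
  have hρ1 : ρ ≤ 1 := by linarith
  obtain ⟨C, hC⟩ := hg.exists_hasExpDecay
  obtain ⟨M, hM⟩ := exists_norm_iterInt_le hρ hg hγ
  refine ⟨(hg.mono hρ1).differentiableOn.mul (differentiableOn_iterInt hρ hgm hg hγ), C * M,
    fun z hz => ?_⟩
  have hgz := hC.mono hρ1 z hz
  calc ‖g z * iterInt g γ z‖ ≤ C * Real.exp (-(1 / 4) * z.re) * M := by
        rw [norm_mul]
        exact mul_le_mul hgz (hM z hz) (norm_nonneg _) ((norm_nonneg _).trans hgz)
    _ = C * M * Real.exp (-(1 / 4) * z.re) := by ring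

/-- The majorant of the integrand is locally uniform in `s`, so the iterated integral is
holomorphic in all variables jointly. -/
lemma differentiableAt_iterInt_param {γ : Fin r → ℂ → WeightedPath} {D : Fin r → Set ℂ}
    {s : Fin r → ℂ} (hρ : ρ + r * δ ≤ 1) (hg : Measurable g)
    (hdecay : HasExpDecay (1 / 4) C 1 g) (hγ : ∀ k, IsContourFamily δ (γ k) (D k))
    (hD : ∀ k, IsOpen (D k)) (hs : ∀ k, s k ∈ D k) (hy : y ∈ halfStrip ρ) :
    DifferentiableAt ℂ (fun s : Fin r → ℂ => iterInt g (fun k => γ k (s k)) y) s := by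
  have hC := hdecay.nonneg one_pos
  choose V hV B hB hint using fun k => (hγ k).dominated (s k) (hs k)
  have hVD : (Set.univ.pi fun k => V k ∩ D k) ∈ 𝓝 s :=
    set_pi_mem_nhds Set.finite_univ fun k _ => inter_mem (hV k) ((hD k).mem_nhds (hs k))
  have hpath : ∀ (q : Fin r → ℂ) k, (γ k (q k)).path = (γ k (s k)).path := fun q k =>
    (hγ k).path_eq _ _
  refine differentiableAt_integral_of_dominated hVD
    (fun q _ => (measurable_iterIntegrand hg (fun k => (hγ k).measurable_path _)
      (fun k => (hγ k).measurable_weight _) y).aestronglyMeasurable) (fun u => ?_)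
    (fun u q hq => (norm_iterIntegrand_le hρ hdecay (fun k => (hγ k).path_mem _) hy u).trans
      (Finset.prod_le_prod (fun k _ => by positivity) fun k _ => ?_))
    (Integrable.fintype_prod (f := fun k x => C * Real.exp (1 / 4) *
      (B k x * Real.exp (-(1 / 4) * ((γ k (s k)).path x).re))) fun k => (hint k).const_mul _)
  · simp only [iterIntegrand, hpath]
    refine DifferentiableOn.mul (differentiableOn_const _) fun q hq =>
      (HasFDerivWithinAt.finsetProd (g := fun k (q : Fin r → ℂ) => (γ k (q k)).weight (u k))
        fun k _ => DifferentiableWithinAt.hasFDerivWithinAt ?_).differentiableWithinAt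
    exact ((hγ k).differentiableOn (u k)).comp
      (differentiable_apply (𝕜 := ℂ) k).differentiableOn
      (fun q hq => (hq k (Set.mem_univ k)).2) q hq
  · rw [hpath]
    gcongr
    exact hB k (q k) (hq k (Set.mem_univ k)).1 (u k)

end IterInt

lemma iterInt_zero (g : ℂ → ℂ) (γ : Fin 0 → WeightedPath) (y : ℂ) : iterInt g γ y = 1 := by
  simp [iterInt, iterIntegrand, measureReal_def, volume_pi]

lemma sum_Ici_succ {r : ℕ} (z : Fin (r + 1) → ℂ) (j : Fin r) :
    ∑ k ∈ Finset.Ici j.castSucc, z k = z (Fin.last r) + ∑ k ∈ Finset.Ici j, z k.castSucc := by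
  rw [← Finset.filter_le_eq_Ici, ← Finset.filter_le_eq_Ici, Finset.sum_filter, Finset.sum_filter,
    Fin.sum_univ_castSucc, add_comm]
  simp [Fin.le_last]

lemma iterIntegrand_snoc {r : ℕ} (g : ℂ → ℂ) (γ : Fin (r + 1) → WeightedPath) (y : ℂ)
    (v : Fin r → ℝ) (x : ℝ) :
    iterIntegrand g γ y (Fin.snoc (α := fun _ => ℝ) v x) =
      (γ (Fin.last r)).pullback (fun z => g (y + z)) x *
        iterIntegrand g (Fin.init γ) (y + (γ (Fin.last r)).path x) v := by
  have hlast : Finset.Ici (Fin.last r) = {Fin.last r} := Finset.Ici_top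
  simp only [iterIntegrand, Fin.prod_univ_castSucc, sum_Ici_succ, hlast, Finset.sum_singleton,
    Fin.snoc_castSucc, Fin.snoc_last, WeightedPath.pullback, Fin.init, add_assoc]
  ring

lemma iterInt_succ {r : ℕ} {g : ℂ → ℂ} {γ : Fin (r + 1) → WeightedPath} {y : ℂ}
    (hint : Integrable (iterIntegrand g γ y)) :
    iterInt g γ y = (γ (Fin.last r)).integral fun z =>
      g (y + z) * iterInt g (Fin.init γ) (y + z) := by
  have hmp := (volume_preserving_piFinSuccAbove (fun _ : Fin (r + 1) => ℝ) (Fin.last r)).symm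
  have hsnoc : ∀ q : ℝ × (Fin r → ℝ), iterIntegrand g γ y
      ((MeasurableEquiv.piFinSuccAbove (fun _ : Fin (r + 1) => ℝ) (Fin.last r)).symm q) =
      (γ (Fin.last r)).pullback (fun z => g (y + z)) q.1 *
        iterIntegrand g (Fin.init γ) (y + (γ (Fin.last r)).path q.1) q.2 := fun q => by
    rw [← iterIntegrand_snoc]
    congr 1
    ext k
    simp [MeasurableEquiv.piFinSuccAbove, Fin.insertNthEquiv, Fin.insertNth_last']
  have hint' := (hmp.integrable_comp_emb (MeasurableEquiv.measurableEmbedding _)).2 hint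
  rw [iterInt, ← hmp.integral_comp']
  simp only [Function.comp_def, hsnoc] at hint' ⊢
  rw [Measure.volume_eq_prod, integral_prod _ hint']
  simp only [integral_const_mul, iterInt, WeightedPath.integral, WeightedPath.pullback, mul_assoc]

lemma iterInt_congr {r : ℕ} {g : ℂ → ℂ} {γ γ' : Fin r → WeightedPath} {δ ρ : ℝ} {y : ℂ}
    (hρ : ρ + r * δ ≤ 1) (hgm : Measurable g) (hg : IsTestFunction 1 g)
    (hγ : ∀ k, IsContour δ (γ k)) (hγ' : ∀ k, IsContour δ (γ' k))
    (he : ∀ k, ContourEquiv δ (γ k) (γ' k)) (hy : y ∈ halfStrip ρ) :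
    iterInt g γ y = iterInt g γ' y := by
  obtain ⟨C, hC⟩ := hg.exists_hasExpDecay
  induction r generalizing ρ y with
  | zero => rw [iterInt_zero, iterInt_zero]
  | succ r ih =>
    have hρ' : (ρ + δ) + r * δ ≤ 1 := by
      push_cast at hρ
      linarith
    have hinit : ∀ z ∈ closedHalfStrip δ,
        iterInt g (Fin.init γ) (y + z) = iterInt g (Fin.init γ') (y + z) := fun z hz =>
      ih hρ' (fun k => hγ k.castSucc) (fun k => hγ' k.castSucc) (fun k => he k.castSucc)
        (add_mem_halfStrip hy hz)
    obtain ⟨ρ', hδρ', htest⟩ := (IsTestFunction.mul_iterInt (γ := Fin.init γ') hρ' hgm hg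
      fun k => hγ' k.castSucc).exists_comp_const_add hy
    rw [iterInt_succ (integrable_iterIntegrand hρ hgm hC hγ hy),
      iterInt_succ (integrable_iterIntegrand hρ hgm hC hγ' hy), ← he (Fin.last r) ρ' _ hδρ' htest]
    simp only [WeightedPath.integral, WeightedPath.pullback, hinit _ ((hγ _).path_mem _)]

/-! ### The Hankel contour and the half-line -/

section HalfLine

variable {E : Type*} [NormedAddCommGroup E] {f : ℝ → E} {a b : ℝ}

lemma integrableOn_Iio_comp_sub_left (h : IntegrableOn f (Set.Ioi a)) :
    IntegrableOn (fun u => f (a - u)) (Set.Iio 0) := by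
  refine (((Measure.measurePreserving_sub_left volume a).integrableOn_comp_preimage
    (MeasurableEquiv.subLeft a).measurableEmbedding).2 h).congr_set_ae (Eq.eventuallyEq ?_)
  ext
  simp

lemma integrableOn_Ioi_comp_add_right :
    IntegrableOn (fun u => f (u + (a - b))) (Set.Ioi b) ↔ IntegrableOn f (Set.Ioi a) := by
  rw [← (measurePreserving_add_right volume (a - b)).integrableOn_comp_preimage
    (MeasurableEquiv.addRight (a - b)).measurableEmbedding (s := Set.Ioi a),
    Set.preimage_add_const_Ioi, sub_sub_cancel]
  rfl

lemma integrable_of_integrableOn_Iio_Ioo_Ioi (h₁ : IntegrableOn f (Set.Iio a))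
    (h₂ : IntegrableOn f (Set.Ioo a b)) (h₃ : IntegrableOn f (Set.Ioi b)) : Integrable f := by
  rw [← integrableOn_univ, ← Set.Iic_union_Ioi (a := a), integrableOn_union,
    integrableOn_Iic_iff_integrableOn_Iio]
  exact ⟨h₁, (IntegrableOn.union (by rwa [integrableOn_Ioc_iff_integrableOn_Ioo]) h₃).mono_set
    Set.Ioi_subset_Ioc_union_Ioi⟩

variable [NormedSpace ℝ E]

lemma integral_Iio_comp_sub_left (f : ℝ → E) (a : ℝ) :
    ∫ u in Set.Iio 0, f (a - u) = ∫ x in Set.Ioi a, f x := by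
  rw [← (Measure.measurePreserving_sub_left volume a).setIntegral_preimage_emb
    (MeasurableEquiv.subLeft a).measurableEmbedding]
  simp

lemma integral_Ioi_comp_add_right (f : ℝ → E) (a b : ℝ) :
    ∫ u in Set.Ioi b, f (u + (a - b)) = ∫ x in Set.Ioi a, f x := by
  rw [← (measurePreserving_add_right volume (a - b)).setIntegral_preimage_emb
    (MeasurableEquiv.addRight (a - b)).measurableEmbedding f, Set.preimage_add_const_Ioi,
    sub_sub_cancel]

lemma tendsto_integral_Ioi_nhdsGT (hf : IntegrableOn f (Set.Ioi a)) :
    Tendsto (fun b => ∫ x in Set.Ioi b, f x) (𝓝[>] a) (𝓝 (∫ x in Set.Ioi a, f x)) := by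
  refine ((aecover_Ioi_of_Ioi (tendsto_nhdsWithin_of_tendsto_nhds
    tendsto_id)).integral_tendsto_of_countably_generated hf).congr' ?_
  filter_upwards [self_mem_nhdsWithin] with b hb
  rw [id_eq, Measure.restrict_restrict measurableSet_Ioi,
    Set.inter_eq_left.2 (Set.Ioi_subset_Ioi (Set.mem_Ioi.1 hb).le)]

end HalfLine

section Hankel

variable {ε u : ℝ}

lemma hankelAbs_of_neg (hu : u < 0) : hankelAbs ε u = ε - u := by
  rw [hankelAbs, max_eq_left (by linarith), max_eq_right (by linarith [Real.pi_pos])]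
  ring

lemma hankelAbs_of_mem (hu : u ∈ Set.Icc 0 (2 * Real.pi)) : hankelAbs ε u = ε := by
  rw [hankelAbs, max_eq_right (by linarith [hu.1]), max_eq_right (by linarith [hu.2])]
  ring

lemma hankelAbs_of_gt (hu : 2 * Real.pi < u) : hankelAbs ε u = u + (ε - 2 * Real.pi) := by
  rw [hankelAbs, max_eq_right (by linarith [Real.pi_pos]), max_eq_left (by linarith)]
  ring

lemma hankelArg_of_neg (hu : u < 0) : hankelArg u = 0 :=
  max_eq_left ((min_le_left _ _).trans hu.le)

lemma hankelArg_of_mem (hu : u ∈ Set.Icc 0 (2 * Real.pi)) : hankelArg u = u := by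
  rw [hankelArg, min_eq_left hu.2, max_eq_right hu.1]

lemma hankelArg_of_gt (hu : 2 * Real.pi < u) : hankelArg u = 2 * Real.pi := by
  rw [hankelArg, min_eq_right hu.le, max_eq_right Real.two_pi_pos.le]

lemma hankel_of_neg (hu : u < 0) : hankel ε u = (ε - u : ℝ) := by
  simp [hankel, hankelAbs_of_neg hu, hankelArg_of_neg hu]

lemma hankel_of_mem (hu : u ∈ Set.Icc 0 (2 * Real.pi)) :
    hankel ε u = ε * Complex.exp (u * Complex.I) := by
  rw [hankel, hankelAbs_of_mem hu, hankelArg_of_mem hu]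

lemma hankel_of_gt (hu : 2 * Real.pi < u) : hankel ε u = (u + (ε - 2 * Real.pi) : ℝ) := by
  rw [hankel, hankelAbs_of_gt hu, hankelArg_of_gt hu, Complex.ofReal_mul, Complex.ofReal_ofNat,
    Complex.exp_two_pi_mul_I, mul_one]

lemma deriv_hankel_of_neg (hu : u < 0) : deriv (hankel ε) u = -1 := by
  have heq : hankel ε =ᶠ[𝓝 u] fun v => ((ε - v : ℝ) : ℂ) := by
    filter_upwards [gt_mem_nhds hu] with v hv using hankel_of_neg hv
  simpa using (((hasDerivAt_id u).const_sub ε).ofReal_comp.congr_of_eventuallyEq heq).deriv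

lemma deriv_hankel_of_mem (hu : u ∈ Set.Ioo 0 (2 * Real.pi)) :
    deriv (hankel ε) u = Complex.I * (ε * Complex.exp (u * Complex.I)) := by
  have heq : hankel ε =ᶠ[𝓝 u] fun v => (ε : ℂ) * Complex.exp (v * Complex.I) := by
    filter_upwards [Ioo_mem_nhds hu.1 hu.2] with v hv using hankel_of_mem ⟨hv.1.le, hv.2.le⟩
  have hmul : HasDerivAt (fun v : ℝ => (v : ℂ) * Complex.I) Complex.I u := by
    simpa using (Complex.ofRealCLM.hasDerivAt (x := u)).mul_const Complex.I
  rw [((hmul.cexp.const_mul (ε : ℂ)).congr_of_eventuallyEq heq).deriv]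
  ring

lemma deriv_hankel_of_gt (hu : 2 * Real.pi < u) : deriv (hankel ε) u = 1 := by
  have heq : hankel ε =ᶠ[𝓝 u] fun v => ((v + (ε - 2 * Real.pi) : ℝ) : ℂ) := by
    filter_upwards [lt_mem_nhds hu] with v hv using hankel_of_gt hv
  simpa using (((hasDerivAt_id u).add_const _).ofReal_comp.congr_of_eventuallyEq heq).deriv

lemma continuous_hankelAbs (ε : ℝ) : Continuous (hankelAbs ε) := by
  unfold hankelAbs
  fun_prop

lemma continuous_hankelArg : Continuous hankelArg := by
  unfold hankelArg
  fun_prop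

lemma continuous_hankel (ε : ℝ) : Continuous (hankel ε) := by
  have := continuous_hankelAbs ε
  have := continuous_hankelArg
  unfold hankel
  fun_prop

lemma hankelArg_mem_Icc (u : ℝ) : hankelArg u ∈ Set.Icc 0 (2 * Real.pi) :=
  ⟨le_max_left _ _, max_le Real.two_pi_pos.le (min_le_right _ _)⟩

lemma hankel_mem_closedHalfStrip (hε : 0 ≤ ε) (u : ℝ) : hankel ε u ∈ closedHalfStrip ε := by
  rcases lt_or_ge u 0 with h | h
  · rw [hankel_of_neg h]
    exact ⟨by rw [Complex.ofReal_re]; linarith, by simpa using hε⟩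
  rcases le_or_gt u (2 * Real.pi) with h' | h'
  · have hn : ‖hankel ε u‖ = ε := by
      rw [hankel_of_mem ⟨h, h'⟩, norm_mul, Complex.norm_exp_ofReal_mul_I, mul_one,
        Complex.norm_of_nonneg hε]
    exact ⟨neg_le_of_abs_le ((Complex.abs_re_le_norm _).trans_eq hn),
      (Complex.abs_im_le_norm _).trans_eq hn⟩
  · rw [hankel_of_gt h']
    exact ⟨by rw [Complex.ofReal_re]; linarith, by simpa using hε⟩

/-- The Hankel contour of radius `ε` with the weight `t ^ (s - 1) dt`. -/
def hankelContour (ε : ℝ) (s : ℂ) : WeightedPath :=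
  ⟨hankel ε, fun u => hankelPow ε u (s - 1) * deriv (hankel ε) u⟩

lemma measurable_hankelPow (ε : ℝ) (a : ℂ) : Measurable fun u => hankelPow ε u a := by
  have := (continuous_hankelAbs ε).measurable
  have := continuous_hankelArg.measurable
  have := Real.measurable_log
  unfold hankelPow
  fun_prop

lemma norm_hankelPow_le {a : ℂ} {A : ℝ} (ha : ‖a‖ ≤ A) (u : ℝ) :
    ‖hankelPow ε u a‖ ≤
      Real.exp (A * (2 * Real.pi)) * Real.exp (A * |Real.log (hankelAbs ε u)|) := by
  obtain ⟨harg₀, harg⟩ := hankelArg_mem_Icc u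
  have hre : a.re * Real.log (hankelAbs ε u) ≤ A * |Real.log (hankelAbs ε u)| := by
    refine (le_abs_self _).trans ?_
    rw [abs_mul]
    gcongr
    exact (Complex.abs_re_le_norm _).trans ha
  have him : -(a.im * hankelArg u) ≤ A * (2 * Real.pi) := by
    refine (neg_le_abs _).trans ?_
    rw [abs_mul, abs_of_nonneg harg₀]
    exact mul_le_mul ((Complex.abs_im_le_norm a).trans ha) harg harg₀ ((norm_nonneg a).trans ha)
  rw [hankelPow, Complex.norm_exp, ← Real.exp_add]
  gcongr
  simp only [Complex.mul_re, Complex.add_re, Complex.ofReal_re, Complex.add_im, Complex.ofReal_im,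
    Complex.mul_im, Complex.I_re, Complex.I_im, mul_zero, mul_one, zero_add, add_zero, sub_zero]
  linarith

lemma integrableOn_exp_abs_log_mul_exp (hε : 0 < ε) (A : ℝ) :
    IntegrableOn (fun x : ℝ => Real.exp (A * |Real.log x|) * Real.exp (-(1 / 4) * x))
      (Set.Ioi ε) := by
  refine integrable_of_isBigO_exp_neg (b := 1 / 8) (by norm_num) ?_ ?_
  · have : ContinuousOn Real.log (Set.Ici ε) :=
      Real.continuousOn_log.mono fun x hx => (hε.trans_le hx).ne'
    fun_prop
  · have hpow := (isLittleO_rpow_exp_pos_mul_atTop A (b := 1 / 8) (by norm_num)).isBigO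
    refine (hpow.mul (Asymptotics.isBigO_refl (fun x : ℝ => Real.exp (-(1 / 4) * x)) atTop)).congr'
      ?_ (Eventually.of_forall fun x => ?_)
    · filter_upwards [eventually_ge_atTop 1] with x hx
      rw [abs_of_nonneg (Real.log_nonneg hx), Real.rpow_def_of_pos (by linarith), mul_comm A]
    · simp only [← Real.exp_add]
      ring_nf

lemma integrable_hankel_majorant (hε : 0 < ε) (A : ℝ) :
    Integrable fun u => Real.exp (A * |Real.log (hankelAbs ε u)|) * ‖deriv (hankel ε) u‖ *
      Real.exp (-(1 / 4) * (hankel ε u).re) := by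
  have hIoi := integrableOn_exp_abs_log_mul_exp hε A
  refine integrable_of_integrableOn_Iio_Ioo_Ioi (a := 0) (b := 2 * Real.pi) ?_ ?_ ?_
  · refine (integrableOn_Iio_comp_sub_left hIoi).congr_fun (fun u hu => ?_) measurableSet_Iio
    simp [hankelAbs_of_neg hu, deriv_hankel_of_neg hu, hankel_of_neg hu]
  · refine IntegrableOn.congr_fun (f := fun u : ℝ => Real.exp (A * |Real.log ε|) * ε *
      Real.exp (-(1 / 4) * ((ε : ℂ) * Complex.exp (u * Complex.I)).re)) ?_ (fun u hu => ?_)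
      measurableSet_Ioo
    · exact (Continuous.integrableOn_Icc (by fun_prop)).mono_set Set.Ioo_subset_Icc_self
    · have hu' := Set.Ioo_subset_Icc_self hu
      simp only [hankelAbs_of_mem hu', deriv_hankel_of_mem hu, hankel_of_mem hu', norm_mul,
        Complex.norm_I, Complex.norm_exp_ofReal_mul_I, Complex.norm_of_nonneg hε.le, one_mul,
        mul_one]
  · refine (integrableOn_Ioi_comp_add_right.2 hIoi).congr_fun (fun u hu => ?_) measurableSet_Ioi
    simp [hankelAbs_of_gt hu, deriv_hankel_of_gt hu, hankel_of_gt hu]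

lemma isContourFamily_hankelContour {δ : ℝ} (hε : 0 < ε) (hδ : ε ≤ δ) :
    IsContourFamily δ (hankelContour ε) Set.univ where
  path_eq _ _ := rfl
  measurable_path _ := (continuous_hankel ε).measurable
  measurable_weight _ := (measurable_hankelPow ε _).mul (measurable_deriv _)
  path_mem _ u := closedHalfStrip_mono hδ (hankel_mem_closedHalfStrip hε.le u)
  differentiableOn u := by
    unfold hankelContour hankelPow
    fun_prop
  dominated s _ := by
    refine ⟨_, Metric.ball_mem_nhds s one_pos, fun u => Real.exp ((‖s - 1‖ + 1) * (2 * Real.pi)) *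
      (Real.exp ((‖s - 1‖ + 1) * |Real.log (hankelAbs ε u)|) * ‖deriv (hankel ε) u‖),
      fun q hq u => ?_, ?_⟩
    · have hq' : ‖q - 1‖ ≤ ‖s - 1‖ + 1 := by
        rw [Metric.mem_ball, dist_eq_norm] at hq
        linarith [norm_sub_le_norm_sub_add_norm_sub q s 1]
      simp only [← mul_assoc (Real.exp _)]
      exact (norm_mul_le _ _).trans
        (mul_le_mul_of_nonneg_right (norm_hankelPow_le hq' u) (norm_nonneg _))
    · simpa only [mul_assoc, hankelContour] using
        (integrable_hankel_majorant hε (‖s - 1‖ + 1)).const_mul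
          (Real.exp ((‖s - 1‖ + 1) * (2 * Real.pi)))

end Hankel

/-- The integrand of the Mellin transform of `F`, restricted to the positive real axis. -/
def mellinForm (F : ℂ → ℂ) (s : ℂ) (x : ℝ) : ℂ := (x : ℂ) ^ (s - 1) * F x

/-- The positive real axis with the weight `t ^ (s - 1) dt`. -/
def rayContour (s : ℂ) : WeightedPath :=
  ⟨fun u => (max u 0 : ℝ), (Set.Ioi 0).indicator fun u => (u : ℂ) ^ (s - 1)⟩

lemma pullback_rayContour (F : ℂ → ℂ) (s : ℂ) :
    (rayContour s).pullback F = (Set.Ioi 0).indicator (mellinForm F s) := by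
  funext u
  by_cases hu : u ∈ Set.Ioi (0 : ℝ)
  · simp only [WeightedPath.pullback, rayContour, mellinForm, Set.indicator_of_mem hu,
      max_eq_left (Set.mem_Ioi.1 hu).le]
  · simp only [WeightedPath.pullback, rayContour, Set.indicator_of_notMem hu, zero_mul]

lemma integral_rayContour (F : ℂ → ℂ) (s : ℂ) :
    (rayContour s).integral F = ∫ x in Set.Ioi 0, mellinForm F s x := by
  rw [WeightedPath.integral, pullback_rayContour, integral_indicator measurableSet_Ioi]

lemma integrable_rayContour_majorant {a : ℝ} (ha : 0 < a) :
    Integrable fun u => (Set.Ioi 0).indicator (fun u : ℝ => u ^ (a - 1)) u *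
      Real.exp (-(1 / 4) * max u 0) := by
  refine ((integrableOn_rpow_mul_exp_neg_mul_rpow (p := 1) (s := a - 1) (b := 1 / 4)
    (by linarith) one_pos (by norm_num)).integrable_indicator measurableSet_Ioi).congr
    (ae_of_all _ fun u => ?_)
  by_cases hu : u ∈ Set.Ioi (0 : ℝ)
  · simp only [Set.indicator_of_mem hu, max_eq_left (Set.mem_Ioi.1 hu).le, Real.rpow_one]
  · simp only [Set.indicator_of_notMem hu, zero_mul]

lemma rpow_le_rpow_add_rpow {x a b c : ℝ} (hx : 0 < x) (hac : a ≤ c) (hcb : c ≤ b) :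
    x ^ c ≤ x ^ a + x ^ b := by
  have ha := Real.rpow_pos_of_pos hx a
  have hb := Real.rpow_pos_of_pos hx b
  rcases le_total x 1 with h | h
  · linarith [Real.rpow_le_rpow_of_exponent_ge hx h hac]
  · linarith [Real.rpow_le_rpow_of_exponent_le h hcb]

lemma isContourFamily_rayContour {δ : ℝ} (hδ : 0 ≤ δ) :
    IsContourFamily δ rayContour {s | 0 < s.re} where
  path_eq _ _ := rfl
  measurable_path _ := by
    unfold rayContour
    fun_prop
  measurable_weight _ := by
    refine Measurable.indicator ?_ measurableSet_Ioi
    fun_prop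
  path_mem _ u := ⟨by simp [rayContour, hδ], by simpa [rayContour] using hδ⟩
  differentiableOn u := by
    by_cases hu : u ∈ Set.Ioi (0 : ℝ)
    · have hu' : (u : ℂ) ∈ Complex.slitPlane := Complex.ofReal_mem_slitPlane.2 hu
      simp only [rayContour, Set.indicator_of_mem hu]
      exact ((differentiable_id.sub_const 1).const_cpow
        (Or.inl (Complex.slitPlane_ne_zero hu'))).differentiableOn
    · simp only [rayContour, Set.indicator_of_notMem hu]
      fun_prop
  dominated s hs := by
    have hs' : 0 < s.re := hs
    refine ⟨{q | s.re / 2 < q.re ∧ q.re < s.re + 1}, ?_, fun u =>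
      (Set.Ioi 0).indicator (fun u : ℝ => u ^ (s.re / 2 - 1)) u +
        (Set.Ioi 0).indicator (fun u : ℝ => u ^ (s.re + 1 - 1)) u, fun q hq u => ?_, ?_⟩
    · exact ((isOpen_lt continuous_const Complex.continuous_re).and
        (isOpen_lt Complex.continuous_re continuous_const)).mem_nhds ⟨by linarith, by linarith⟩
    · by_cases hu : u ∈ Set.Ioi (0 : ℝ)
      · simp only [rayContour, Set.indicator_of_mem hu, Complex.norm_cpow_eq_rpow_re_of_pos hu,
          Complex.sub_re, Complex.one_re]
        exact rpow_le_rpow_add_rpow hu (by linarith [hq.1]) (by linarith [hq.2])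
      · simp [rayContour, Set.indicator_of_notMem hu]
    · simp only [add_mul]
      exact (integrable_rayContour_majorant (half_pos hs')).add
        (integrable_rayContour_majorant (by linarith))

section HankelIntegral

variable {ε u : ℝ} {F : ℂ → ℂ} {s : ℂ}

/-- The differential form `F t * t ^ (s - 1) dt` in the coordinate `w = log t`. -/
def logForm (F : ℂ → ℂ) (s w : ℂ) : ℂ := F (Complex.exp w) * Complex.exp (s * w)

/-- The integral of `F t * t ^ (s - 1) dt` over the circle of radius `ε`, where the argument of `t`
runs from `0` to `2π`. -/
def circlePart (F : ℂ → ℂ) (s : ℂ) (ε : ℝ) : ℂ :=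
  ∫ θ in (0 : ℝ)..2 * Real.pi, Complex.I * logForm F s (Real.log ε + θ * Complex.I)

lemma logForm_add_two_pi (F : ℂ → ℂ) (s w : ℂ) :
    logForm F s (w + 2 * Real.pi * Complex.I) =
      Complex.exp (2 * Real.pi * Complex.I * s) * logForm F s w := by
  have hexp : Complex.exp (s * (w + 2 * Real.pi * Complex.I)) =
      Complex.exp (2 * Real.pi * Complex.I * s) * Complex.exp (s * w) := by
    rw [← Complex.exp_add]
    ring_nf
  rw [logForm, Complex.exp_periodic w, hexp, mul_left_comm, logForm]

lemma hankelPow_eq_cpow_mul (h : 0 < hankelAbs ε u) (a : ℂ) :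
    hankelPow ε u a = (hankelAbs ε u : ℂ) ^ a * Complex.exp (a * (hankelArg u * Complex.I)) := by
  rw [hankelPow, Complex.cpow_def_of_ne_zero (Complex.ofReal_ne_zero.2 h.ne'), ← Complex.exp_add,
    ← Complex.ofReal_log h.le]
  ring_nf

lemma pullback_hankelContour_of_neg (hε : 0 < ε) (hu : u < 0) :
    (hankelContour ε s).pullback F u = -mellinForm F s (ε - u) := by
  have hpos : 0 < hankelAbs ε u := by
    rw [hankelAbs_of_neg hu]
    linarith
  simp [WeightedPath.pullback, hankelContour, mellinForm, hankelPow_eq_cpow_mul hpos,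
    hankelAbs_of_neg hu, hankelArg_of_neg hu, hankel_of_neg hu, deriv_hankel_of_neg hu]

lemma pullback_hankelContour_of_mem (hε : 0 < ε) (hu : u ∈ Set.Ioo 0 (2 * Real.pi)) :
    (hankelContour ε s).pullback F u =
      Complex.I * logForm F s (Real.log ε + u * Complex.I) := by
  have hu' := Set.Ioo_subset_Icc_self hu
  have hexp : (ε : ℂ) * Complex.exp (u * Complex.I) =
      Complex.exp (Real.log ε + u * Complex.I) := by
    rw [Complex.exp_add, ← Complex.ofReal_exp, Real.exp_log hε]
  have hpow : Complex.exp (s * (Real.log ε + u * Complex.I)) =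
      Complex.exp ((s - 1) * (Real.log ε + u * Complex.I)) *
        Complex.exp (Real.log ε + u * Complex.I) := by
    rw [← Complex.exp_add]
    ring_nf
  simp only [WeightedPath.pullback, hankelContour, hankelPow, hankel_of_mem hu',
    hankelAbs_of_mem hu', hankelArg_of_mem hu', deriv_hankel_of_mem hu, logForm, hexp, hpow]
  ring

lemma pullback_hankelContour_of_gt (hε : 0 < ε) (hu : 2 * Real.pi < u) :
    (hankelContour ε s).pullback F u =
      Complex.exp (2 * Real.pi * Complex.I * s) * mellinForm F s (u + (ε - 2 * Real.pi)) := by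
  have hpos : 0 < hankelAbs ε u := by
    rw [hankelAbs_of_gt hu]
    linarith
  have hexp : Complex.exp ((s - 1) * (((2 * Real.pi : ℝ) : ℂ) * Complex.I)) =
      Complex.exp (2 * Real.pi * Complex.I * s) := by
    rw [← Complex.exp_periodic.sub_eq (2 * Real.pi * Complex.I * s)]
    push_cast
    ring_nf
  simp only [WeightedPath.pullback, hankelContour, mellinForm, hankelPow_eq_cpow_mul hpos,
    hankelAbs_of_gt hu, hankelArg_of_gt hu, hankel_of_gt hu, deriv_hankel_of_gt hu, hexp]
  ring

lemma integrableOn_mellinForm_Ioi (hε : 0 < ε)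
    (hint : Integrable ((hankelContour ε s).pullback F)) :
    IntegrableOn (mellinForm F s) (Set.Ioi ε) := by
  rw [← integrableOn_Ioi_comp_add_right (b := 2 * Real.pi)]
  refine IntegrableOn.congr_fun
    (hint.const_mul (Complex.exp (2 * Real.pi * Complex.I * s))⁻¹).integrableOn
    (fun u hu => ?_) measurableSet_Ioi
  simp only [pullback_hankelContour_of_gt hε hu, inv_mul_cancel_left₀ (Complex.exp_ne_zero _)]

lemma integral_hankelContour (hε : 0 < ε)
    (hint : Integrable ((hankelContour ε s).pullback F)) :
    (hankelContour ε s).integral F = circlePart F s ε +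
      (Complex.exp (2 * Real.pi * Complex.I * s) - 1) * ∫ x in Set.Ioi ε, mellinForm F s x := by
  have hleft : ∫ u in Set.Iic 0, (hankelContour ε s).pullback F u =
      -∫ x in Set.Ioi ε, mellinForm F s x := by
    rw [integral_Iic_eq_integral_Iio, ← integral_Iio_comp_sub_left, ← integral_neg]
    exact setIntegral_congr_fun measurableSet_Iio fun u hu => pullback_hankelContour_of_neg hε hu
  have hcircle : ∫ u in (0)..2 * Real.pi, (hankelContour ε s).pullback F u =
      circlePart F s ε := by
    rw [circlePart, intervalIntegral.integral_of_le Real.two_pi_pos.le,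
      intervalIntegral.integral_of_le Real.two_pi_pos.le, integral_Ioc_eq_integral_Ioo,
      integral_Ioc_eq_integral_Ioo]
    exact setIntegral_congr_fun measurableSet_Ioo fun u hu => pullback_hankelContour_of_mem hε hu
  have hright : ∫ u in Set.Ioi (2 * Real.pi), (hankelContour ε s).pullback F u =
      Complex.exp (2 * Real.pi * Complex.I * s) * ∫ x in Set.Ioi ε, mellinForm F s x := by
    rw [← integral_Ioi_comp_add_right _ ε (2 * Real.pi), ← integral_const_mul]
    exact setIntegral_congr_fun measurableSet_Ioi fun u hu => pullback_hankelContour_of_gt hε hu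
  rw [WeightedPath.integral, ← intervalIntegral.integral_Iic_add_Ioi hint.integrableOn
    hint.integrableOn, ← intervalIntegral.integral_interval_add_Ioi hint.integrableOn
    hint.integrableOn, hleft, hcircle, hright]
  ring

lemma intervalIntegral_logForm {a b : ℝ} (hF : ContinuousOn (fun x : ℝ => F x) (Set.Ioi 0)) :
    ∫ x in a..b, logForm F s x = ∫ x in Real.exp a..Real.exp b, mellinForm F s x := by
  have himage : Real.exp '' Set.uIcc a b ⊆ Set.Ioi 0 := by
    rintro _ ⟨x, _, rfl⟩
    exact Real.exp_pos x
  have hcont : ContinuousOn (mellinForm F s) (Real.exp '' Set.uIcc a b) := by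
    refine ContinuousOn.mul (fun x hx => ?_) (hF.mono himage)
    exact (Complex.continuousAt_ofReal_cpow_const x _
      (Or.inr (himage hx).ne')).continuousWithinAt
  rw [← intervalIntegral.integral_deriv_smul_comp'' Real.continuous_exp.continuousOn
    (fun x _ => (Real.hasDerivAt_exp x).hasDerivWithinAt) Real.continuous_exp.continuousOn hcont]
  refine intervalIntegral.integral_congr fun x _ => ?_
  have hpow : Complex.exp (s * x) = Complex.exp x * (Real.exp x : ℂ) ^ (s - 1) := by
    rw [Complex.cpow_def_of_ne_zero (Complex.ofReal_ne_zero.2 (Real.exp_pos x).ne'),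
      ← Complex.ofReal_log (Real.exp_pos x).le, Real.log_exp, ← Complex.exp_add]
    ring_nf
  simp only [logForm, mellinForm, Function.comp_apply, Complex.real_smul, hpow,
    Complex.ofReal_exp]
  ring

/- Cauchy's theorem for the rectangle with corners `log ε'` and `log ε + 2πi` in the coordinate
`w = log t`. -/
lemma circlePart_sub_circlePart {ε' : ℝ} (hε : 0 < ε) (hε' : 0 < ε')
    (hF : DifferentiableOn ℂ F (Metric.closedBall 0 (max ε' ε)))
    (hFc : ContinuousOn (fun x : ℝ => F x) (Set.Ioi 0)) :
    circlePart F s ε - circlePart F s ε' =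
      (Complex.exp (2 * Real.pi * Complex.I * s) - 1) * ∫ x in ε'..ε, mellinForm F s x := by
  have hrect : DifferentiableOn ℂ (logForm F s)
      (Set.uIcc (Real.log ε' : ℂ).re (Real.log ε + 2 * Real.pi * Complex.I : ℂ).re ×ℂ
        Set.uIcc (Real.log ε' : ℂ).im (Real.log ε + 2 * Real.pi * Complex.I : ℂ).im) := by
    refine DifferentiableOn.mul (hF.comp Complex.differentiable_exp.differentiableOn
      fun w hw => ?_) (by fun_prop)
    have hre : w.re ≤ max (Real.log ε') (Real.log ε) := by
      simpa [Set.uIcc] using hw.1.2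
    rw [mem_closedBall_zero_iff, Complex.norm_exp]
    rcases le_max_iff.1 hre with h | h
    · exact le_max_of_le_left ((Real.le_log_iff_exp_le hε').1 h)
    · exact le_max_of_le_right ((Real.le_log_iff_exp_le hε).1 h)
  have hre : (Real.log ε + 2 * Real.pi * Complex.I : ℂ).re = Real.log ε := by simp
  have him : (Real.log ε + 2 * Real.pi * Complex.I : ℂ).im = 2 * Real.pi := by simp
  have hcauchy := Complex.integral_boundary_rect_eq_zero_of_differentiableOn _ _ _ hrect
  have hmellin := intervalIntegral_logForm (s := s) (a := Real.log ε') (b := Real.log ε) hFc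
  rw [Real.exp_log hε, Real.exp_log hε'] at hmellin
  simp only [hre, him, Complex.ofReal_re, Complex.ofReal_im, Complex.ofReal_zero, zero_mul,
    add_zero, smul_eq_mul, Complex.ofReal_mul, Complex.ofReal_ofNat, logForm_add_two_pi,
    intervalIntegral.integral_const_mul, hmellin] at hcauchy
  simp only [circlePart, intervalIntegral.integral_const_mul]
  linear_combination hcauchy

lemma norm_circlePart_le {M : ℝ} (hε : 0 < ε) (hM : ∀ z ∈ Metric.closedBall 0 ε, ‖F z‖ ≤ M) :
    ‖circlePart F s ε‖ ≤ M * (Real.exp (|s.im| * (2 * Real.pi)) * ε ^ s.re) * (2 * Real.pi) := by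
  refine (intervalIntegral.norm_integral_le_of_norm_le_const fun θ hθ => ?_).trans_eq
    (by rw [sub_zero, abs_of_pos Real.two_pi_pos])
  rw [Set.uIoc_of_le Real.two_pi_pos.le] at hθ
  have hbound := hM (Complex.exp (Real.log ε + θ * Complex.I)) (by
    rw [mem_closedBall_zero_iff, Complex.norm_exp]
    simp [Real.exp_log hε])
  rw [norm_mul, Complex.norm_I, one_mul, logForm, norm_mul]
  refine mul_le_mul hbound ?_ (norm_nonneg _) ((norm_nonneg _).trans hbound)
  have him : -(s.im * θ) ≤ |s.im| * (2 * Real.pi) := by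
    refine (neg_le_abs _).trans ?_
    rw [abs_mul, abs_of_pos hθ.1]
    gcongr
    exact hθ.2
  have hre : (s * (Real.log ε + θ * Complex.I)).re = s.re * Real.log ε - s.im * θ := by
    simp [Complex.mul_re]
  rw [Complex.norm_exp, Real.rpow_def_of_pos hε, ← Real.exp_add, hre]
  gcongr
  linarith

lemma tendsto_circlePart (hs : 0 < s.re) (hF : ContinuousAt F 0) :
    Tendsto (circlePart F s) (𝓝[>] 0) (𝓝 0) := by
  have hM : ∀ᶠ z in 𝓝 0, ‖F z‖ ≤ ‖F 0‖ + 1 :=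
    (hF.norm.eventually_lt_const (lt_add_one _)).mono fun z hz => hz.le
  obtain ⟨ρ, hρ, hball⟩ := Metric.nhds_basis_closedBall.eventually_iff.1 hM
  have hlim : Tendsto (fun ε : ℝ => (‖F 0‖ + 1) *
      (Real.exp (|s.im| * (2 * Real.pi)) * ε ^ s.re) * (2 * Real.pi)) (𝓝[>] 0) (𝓝 0) := by
    have hrpow : Tendsto (fun ε : ℝ => ε ^ s.re) (𝓝[>] 0) (𝓝 0) := by
      simpa [Real.zero_rpow hs.ne'] using
        ((Real.continuousAt_rpow_const 0 s.re (Or.inr hs.le)).tendsto).mono_left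
          nhdsWithin_le_nhds
    simpa using ((hrpow.const_mul _).const_mul _).mul_const (2 * Real.pi)
  refine squeeze_zero_norm' ?_ hlim
  filter_upwards [Ioc_mem_nhdsGT hρ] with ε hε
  exact norm_circlePart_le hε.1 fun z hz => hball (Metric.closedBall_subset_closedBall hε.2 hz)

end HankelIntegral

section Equivalence

variable {δ ε ε' : ℝ}

lemma closedBall_subset_halfStrip {ρ : ℝ} (h : δ < ρ) : Metric.closedBall 0 δ ⊆ halfStrip ρ := by
  refine Set.Subset.trans (fun z hz => ?_) (closedHalfStrip_subset_halfStrip h)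
  rw [mem_closedBall_zero_iff] at hz
  exact ⟨neg_le_of_abs_le ((Complex.abs_re_le_norm z).trans hz),
    (Complex.abs_im_le_norm z).trans hz⟩

lemma IsTestFunction.continuousOn_ofReal {ρ : ℝ} {f : ℂ → ℂ} (hρ : 0 < ρ)
    (hf : IsTestFunction ρ f) : ContinuousOn (fun x : ℝ => f x) (Set.Ioi 0) := by
  refine hf.differentiableOn.continuousOn.comp Complex.continuous_ofReal.continuousOn ?_
  intro x hx
  refine ⟨?_, ?_⟩
  · rw [Complex.ofReal_re]
    linarith [Set.mem_Ioi.1 hx]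
  · rwa [Complex.ofReal_im, abs_zero]

lemma contourEquiv_hankelContour (hε : 0 < ε) (hεδ : ε ≤ δ) (hε' : 0 < ε') (hεδ' : ε' ≤ δ)
    (s : ℂ) : ContourEquiv δ (hankelContour ε s) (hankelContour ε' s) := by
  intro ρ f hρ hf
  have hint : ∀ η, 0 < η → η ≤ δ → Integrable ((hankelContour η s).pullback f) := fun η h h' =>
    ((isContourFamily_hankelContour h h').isContour (Set.mem_univ s)).integrable_pullback hρ hf
  have hcircle := circlePart_sub_circlePart (s := s) hε hε' (hf.differentiableOn.mono
    (closedBall_subset_halfStrip ((max_le hεδ' hεδ).trans_lt hρ)))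
    (hf.continuousOn_ofReal (hε.trans_le (hεδ.trans hρ.le)))
  rw [integral_hankelContour hε (hint ε hε hεδ), integral_hankelContour hε' (hint ε' hε' hεδ'),
    ← intervalIntegral.integral_interval_add_Ioi
      (integrableOn_mellinForm_Ioi hε' (hint ε' hε' hεδ'))
      (integrableOn_mellinForm_Ioi hε (hint ε hε hεδ))]
  linear_combination hcircle

lemma contourEquiv_hankelContour_rayContour {s : ℂ} (hs : 0 < s.re) (hε : 0 < ε) (hεδ : ε ≤ δ) :
    ContourEquiv δ (hankelContour ε s)
      ((Complex.exp (2 * Real.pi * Complex.I * s) - 1) • rayContour s) := by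
  intro ρ f hρ hf
  have hρ0 : 0 < ρ := hε.trans_le (hεδ.trans hρ.le)
  have hray : IntegrableOn (mellinForm f s) (Set.Ioi 0) := by
    rw [← integrable_indicator_iff measurableSet_Ioi, ← pullback_rayContour]
    exact ((isContourFamily_rayContour (hε.le.trans hεδ)).isContour hs).integrable_pullback hρ hf
  have hlim := (tendsto_circlePart hs (hf.differentiableOn.continuousOn.continuousAt
    ((isOpen_halfStrip ρ).mem_nhds (zero_mem_halfStrip hρ0)))).add
      ((tendsto_integral_Ioi_nhdsGT hray).const_mul
        (Complex.exp (2 * Real.pi * Complex.I * s) - 1))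
  rw [zero_add] at hlim
  rw [WeightedPath.integral_smul, integral_rayContour]
  refine tendsto_nhds_unique (tendsto_const_nhds.congr' ?_) hlim
  filter_upwards [Ioc_mem_nhdsGT hε] with η hη
  rw [← integral_hankelContour hη.1 (((isContourFamily_hankelContour hη.1
    (hη.2.trans hεδ)).isContour (Set.mem_univ s)).integrable_pullback hρ hf)]
  exact contourEquiv_hankelContour hε hεδ hη.1 (hη.2.trans hεδ) s ρ f hρ hf

end Equivalence

/-! ### The entire continuation -/

/-- The coefficient `1 / ((e ^ (2πis) - 1) Γ(s))`, rewritten with the reflection formula so that it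
also makes sense at the nonpositive integers, see `one_div_exp_sub_one_mul_Gamma`. -/
def hankelCoeff (s : ℂ) : ℂ :=
  Complex.exp (-(Real.pi * Complex.I * s)) * Complex.Gamma (1 - s) / (2 * Real.pi * Complex.I)

lemma differentiableOn_hankelCoeff : DifferentiableOn ℂ hankelCoeff {s | s.re < 1} := by
  intro s hs
  have hGamma : DifferentiableAt ℂ (fun s => Complex.Gamma (1 - s)) s := by
    refine DifferentiableAt.comp s (g := Complex.Gamma)
      (Complex.differentiableAt_Gamma _ fun m hm => ?_) (by fun_prop)
    have hre := congrArg Complex.re hm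
    simp only [Complex.sub_re, Complex.one_re, Complex.neg_re, Complex.natCast_re] at hre
    linarith [m.cast_nonneg (α := ℝ), Set.mem_ofPred_eq ▸ hs]
  refine DifferentiableAt.differentiableWithinAt ?_
  unfold hankelCoeff
  fun_prop

lemma exp_two_pi_mul_I_mul_sub_one (s : ℂ) : Complex.exp (2 * Real.pi * Complex.I * s) - 1 =
    2 * Complex.I * Complex.exp (Real.pi * Complex.I * s) * Complex.sin (Real.pi * s) := by
  have hsq : Complex.exp (2 * Real.pi * Complex.I * s) =
      Complex.exp (Real.pi * Complex.I * s) * Complex.exp (Real.pi * Complex.I * s) := by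
    rw [← Complex.exp_add]
    ring_nf
  have hinv : Complex.exp (-(Real.pi * s) * Complex.I) *
      Complex.exp (Real.pi * Complex.I * s) = 1 := by
    rw [← Complex.exp_add, ← Complex.exp_zero]
    ring_nf
  rw [hsq, Complex.sin, show (Real.pi : ℂ) * s * Complex.I = Real.pi * Complex.I * s by ring]
  linear_combination hinv - (Complex.exp (-(Real.pi * s) * Complex.I) *
    Complex.exp (Real.pi * Complex.I * s) - Complex.exp (Real.pi * Complex.I * s) *
    Complex.exp (Real.pi * Complex.I * s)) * Complex.I_sq

section NonInteger

variable {s : ℂ}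

lemma sin_pi_mul_ne_zero (hs : ∀ n : ℤ, s ≠ n) : Complex.sin (Real.pi * s) ≠ 0 := by
  rw [Complex.sin_ne_zero_iff]
  intro k hk
  have hπ : (Real.pi : ℂ) ≠ 0 := by exact_mod_cast Real.pi_ne_zero
  exact hs k (mul_left_cancel₀ hπ (by rw [hk]; ring))

lemma exp_two_pi_mul_I_mul_sub_one_ne_zero (hs : ∀ n : ℤ, s ≠ n) :
    Complex.exp (2 * Real.pi * Complex.I * s) - 1 ≠ 0 := by
  rw [exp_two_pi_mul_I_mul_sub_one]
  simp [sin_pi_mul_ne_zero hs, Complex.exp_ne_zero]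

lemma hankelCoeff_mul_exp_sub_one (hs : ∀ n : ℤ, s ≠ n) :
    hankelCoeff s * (Complex.exp (2 * Real.pi * Complex.I * s) - 1) = (Complex.Gamma s)⁻¹ := by
  have hreflect := Complex.Gamma_mul_Gamma_one_sub s
  rw [eq_div_iff (sin_pi_mul_ne_zero hs)] at hreflect
  have hinv : Complex.exp (-(Real.pi * Complex.I * s)) *
      Complex.exp (Real.pi * Complex.I * s) = 1 := by
    rw [← Complex.exp_add, neg_add_cancel, Complex.exp_zero]
  refine eq_inv_of_mul_eq_one_left ?_
  rw [exp_two_pi_mul_I_mul_sub_one, hankelCoeff, div_mul_eq_mul_div, div_mul_eq_mul_div,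
    div_eq_one_iff_eq Complex.two_pi_I_ne_zero]
  linear_combination 2 * Complex.I * Complex.exp (-(Real.pi * Complex.I * s)) *
    Complex.exp (Real.pi * Complex.I * s) * hreflect + 2 * Complex.I * Real.pi * hinv

lemma one_div_exp_sub_one_mul_Gamma (hs : ∀ n : ℤ, s ≠ n) :
    1 / ((Complex.exp (2 * Real.pi * Complex.I * s) - 1) * Complex.Gamma s) = hankelCoeff s := by
  rw [one_div, mul_inv, ← hankelCoeff_mul_exp_sub_one hs, mul_comm (hankelCoeff s),
    inv_mul_cancel_left₀ (exp_two_pi_mul_I_mul_sub_one_ne_zero hs)]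

lemma ne_intCast_of_re_mem_Ioo (hs : s.re ∈ Set.Ioo 0 1) (n : ℤ) : s ≠ n := by
  rintro rfl
  obtain ⟨h0, h1⟩ := hs
  rw [Complex.intCast_re] at h0 h1
  norm_cast at h0 h1
  omega

end NonInteger

/-- The Hankel contour with the weight `t ^ (s - 1)`, normalized by the coefficient
`1 / ((e ^ (2πis) - 1) Γ(s))`. -/
def normHankel (ε : ℝ) (s : ℂ) : WeightedPath := hankelCoeff s • hankelContour ε s

/-- The positive half-line with the weight `t ^ (s - 1) / Γ(s)`. Along it the integral is a
normalized Mellin transform. -/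
def normRay (s : ℂ) : WeightedPath := (Complex.Gamma s)⁻¹ • rayContour s

/-- A weighted path for every exponent `s`, along which the integral is entire in `s`: normalized
Hankel contours are holomorphic only for `re s < 1`, and half-lines only for `0 < re s`. -/
def desContour (δ : ℝ) (s : ℂ) : WeightedPath :=
  if 1 / 2 < s.re then normRay s else normHankel δ s

section NormalizedContours

variable {ε ε' δ : ℝ} {s : ℂ}

lemma isContour_normHankel (hε : 0 < ε) (hεδ : ε ≤ δ) (s : ℂ) : IsContour δ (normHankel ε s) :=
  ((isContourFamily_hankelContour hε hεδ).isContour (Set.mem_univ s)).smul _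

lemma isContourFamily_normHankel (hε : 0 < ε) (hεδ : ε ≤ δ) :
    IsContourFamily δ (normHankel ε) {s | s.re < 1} :=
  (isContourFamily_hankelContour hε hεδ).smul (isOpen_lt Complex.continuous_re continuous_const)
    (Set.subset_univ _) differentiableOn_hankelCoeff

lemma isContourFamily_normRay (hδ : 0 ≤ δ) : IsContourFamily δ normRay {s | 0 < s.re} :=
  (isContourFamily_rayContour hδ).smul (isOpen_lt continuous_const Complex.continuous_re) subset_rfl
    Complex.differentiable_one_div_Gamma.differentiableOn

lemma contourEquiv_normHankel (hε : 0 < ε) (hεδ : ε ≤ δ) (hε' : 0 < ε') (hεδ' : ε' ≤ δ) (s : ℂ) :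
    ContourEquiv δ (normHankel ε s) (normHankel ε' s) := fun ρ f hρ hf => by
  simp only [normHankel, WeightedPath.integral_smul,
    contourEquiv_hankelContour hε hεδ hε' hεδ' s ρ f hρ hf]

lemma contourEquiv_normHankel_normRay (hε : 0 < ε) (hεδ : ε ≤ δ) (hs : 0 < s.re)
    (hs' : ∀ n : ℤ, s ≠ n) : ContourEquiv δ (normHankel ε s) (normRay s) := fun ρ f hρ hf => by
  simp only [normHankel, normRay, WeightedPath.integral_smul,
    contourEquiv_hankelContour_rayContour hs hε hεδ ρ f hρ hf, ← mul_assoc,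
    hankelCoeff_mul_exp_sub_one hs']

lemma isContour_desContour (hδ : 0 < δ) (s : ℂ) : IsContour δ (desContour δ s) := by
  unfold desContour
  split_ifs with h
  · exact (isContourFamily_normRay hδ.le).isContour (one_half_pos.trans h)
  · exact isContour_normHankel hδ le_rfl s

lemma contourEquiv_desContour_normHankel (hε : 0 < ε) (hεδ : ε ≤ δ) (hs : ∀ n : ℤ, s ≠ n) :
    ContourEquiv δ (desContour δ s) (normHankel ε s) := by
  unfold desContour
  split_ifs with h
  · exact (contourEquiv_normHankel_normRay hε hεδ (one_half_pos.trans h) hs).symm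
  · exact contourEquiv_normHankel (hε.trans_le hεδ) le_rfl hε hεδ s

lemma exists_isContourFamily_contourEquiv_desContour (hδ : 0 < δ) (s₀ : ℂ) :
    ∃ γ D, IsOpen D ∧ s₀ ∈ D ∧ IsContourFamily δ γ D ∧
      ∀ s ∈ D, ContourEquiv δ (desContour δ s) (γ s) := by
  by_cases h₀ : 1 / 2 < s₀.re
  · refine ⟨normRay, {s | 0 < s.re}, isOpen_lt continuous_const Complex.continuous_re,
      one_half_pos.trans h₀, isContourFamily_normRay hδ.le, fun s (hs : 0 < s.re) => ?_⟩
    by_cases h : 1 / 2 < s.re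
    · rw [desContour, if_pos h]
      exact .refl _ _
    · rw [desContour, if_neg h]
      exact contourEquiv_normHankel_normRay hδ le_rfl hs
        (ne_intCast_of_re_mem_Ioo ⟨hs, by linarith⟩)
  · refine ⟨normHankel δ, {s | s.re < 1}, isOpen_lt Complex.continuous_re continuous_const,
      show s₀.re < 1 by linarith, isContourFamily_normHankel hδ le_rfl,
      fun s (hs : s.re < 1) => ?_⟩
    by_cases h : 1 / 2 < s.re
    · exact contourEquiv_desContour_normHankel hδ le_rfl
        (ne_intCast_of_re_mem_Ioo ⟨by linarith, hs⟩)
    · rw [desContour, if_neg h]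
      exact .refl _ _

end NormalizedContours

lemma isTestFunction_desKernel : IsTestFunction 1 desKernel := by
  obtain ⟨C, hC⟩ := exists_hasExpDecay_desKernel
  have hC0 := hC.nonneg two_pos
  refine ⟨differentiableOn_desKernel.mono (halfStrip_subset_strip one_le_two),
    C * Real.exp (1 / 4), fun z hz => ?_⟩
  calc ‖desKernel z‖ ≤ C * Real.exp (-(1 / 2) * z.re) := hC z (halfStrip_mono one_le_two hz)
    _ ≤ C * Real.exp (1 / 4 + -(1 / 4) * z.re) := by
        gcongr
        linarith [hz.1]
    _ = C * Real.exp (1 / 4) * Real.exp (-(1 / 4) * z.re) := by rw [Real.exp_add, mul_assoc]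

/-- A bound for the radii of the Hankel contours in depth `r`: for points `t₁, …, tᵣ` of such
contours and `y` in the half-strip of this width, the sums `y + tⱼ + ⋯ + tᵣ` stay in
`halfStrip 1`. -/
def depthRadius (r : ℕ) : ℝ := 1 / (r + 1)

lemma depthRadius_pos (r : ℕ) : 0 < depthRadius r := Nat.one_div_pos_of_nat

lemma depthRadius_add_mul (r : ℕ) : depthRadius r + r * depthRadius r ≤ 1 := by
  refine le_of_eq ?_
  unfold depthRadius
  field_simp
  ring

/-- The desingularized multiple zeta function as an iterated contour integral. -/
def desZetaInt (r : ℕ) (s : Fin r → ℂ) : ℂ :=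
  iterInt desKernel (fun k => desContour (depthRadius r) (s k)) 0

lemma differentiable_desZetaInt (r : ℕ) : Differentiable ℂ (desZetaInt r) := by
  intro s₀
  have hδ := depthRadius_pos r
  have h0 := zero_mem_halfStrip hδ
  obtain ⟨C, hC⟩ := isTestFunction_desKernel.exists_hasExpDecay
  choose γ D hD hs₀ hγ he using fun k =>
    exists_isContourFamily_contourEquiv_desContour hδ (s₀ k)
  refine (differentiableAt_iterInt_param (depthRadius_add_mul r) measurable_desKernel hC hγ hD hs₀
    h0).congr_of_eventuallyEq ?_
  filter_upwards [set_pi_mem_nhds Set.finite_univ fun k _ => (hD k).mem_nhds (hs₀ k)] with s hs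
  have hs k : s k ∈ D k := hs k (Set.mem_univ k)
  exact iterInt_congr (depthRadius_add_mul r) measurable_desKernel isTestFunction_desKernel
    (fun k => isContour_desContour hδ (s k)) (fun k => (hγ k).isContour (hs k))
    (fun k => he k (s k) (hs k)) h0

section NonIntegerExponents

variable {r : ℕ} {s : Fin r → ℂ} {ε : ℝ}

lemma desZetaInt_eq_iterInt_normHankel (hε : 0 < ε) (hεr : ε ≤ depthRadius r)
    (hs : ∀ (j : Fin r) (n : ℤ), s j ≠ n) :
    desZetaInt r s = iterInt desKernel (fun k => normHankel ε (s k)) 0 :=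
  iterInt_congr (depthRadius_add_mul r) measurable_desKernel isTestFunction_desKernel
    (fun k => isContour_desContour (depthRadius_pos r) (s k))
    (fun k => isContour_normHankel hε hεr (s k))
    (fun k => contourEquiv_desContour_normHankel hε hεr (hs k))
    (zero_mem_halfStrip (depthRadius_pos r))

lemma integrand_eq_iterIntegrand (s : Fin r → ℂ) (ε c : ℝ) :
    integrand r s ε c = iterIntegrand (kernel c) (fun k => hankelContour ε (s k)) 0 := by
  funext u
  simp only [integrand, genFun, iterIntegrand, zero_add, hankelContour]

lemma preDesZeta_eq_iterInt (hs : ∀ (j : Fin r) (n : ℤ), s j ≠ n) (ε c : ℝ) :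
    preDesZeta r s ε c =
      iterInt (fun y => kernel c y / (1 - c)) (fun k => normHankel ε (s k)) 0 := by
  have hcoeff : coeff r s = ∏ k, hankelCoeff (s k) :=
    Finset.prod_congr rfl fun k _ => one_div_exp_sub_one_mul_Gamma (hs k)
  rw [preDesZeta, hcoeff, integrand_eq_iterIntegrand, ← integral_const_mul, ← integral_const_mul,
    iterInt]
  congr 1
  funext u
  simp only [iterIntegrand, normHankel, WeightedPath.path_smul, WeightedPath.weight_smul,
    Finset.prod_mul_distrib, Finset.prod_div_distrib, Finset.prod_const, Finset.card_univ,
    Fintype.card_fin]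
  ring

lemma eventually_mem_Ioo_and_ne_one : ∀ᶠ c : ℝ in 𝓝[≠] 1, c ∈ Set.Ioo (1 / 2) 2 ∧ c ≠ 1 := by
  filter_upwards [self_mem_nhdsWithin,
    nhdsWithin_le_nhds (Ioo_mem_nhds one_half_lt_one one_lt_two)] with c hne hmem
  exact ⟨hmem, hne⟩

lemma eventually_integrable_integrand (hε : 0 < ε) (hεr : ε ≤ depthRadius r) (s : Fin r → ℂ) :
    ∀ᶠ c : ℝ in 𝓝[≠] 1, Integrable (integrand r s ε c) := by
  obtain ⟨C, hC⟩ := exists_hasExpDecay_kernel_div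
  filter_upwards [eventually_mem_Ioo_and_ne_one] with c ⟨hc, hc1⟩
  have hdecay : HasExpDecay (1 / 4) (C * ‖1 - (c : ℂ)‖) 1 (kernel c) := fun z hz => by
    have hne : 1 - (c : ℂ) ≠ 0 := sub_ne_zero.2 (by exact_mod_cast hc1.symm)
    have hle := hC c hc hc1 z hz
    rw [norm_div, div_le_iff₀ (norm_pos_iff.2 hne)] at hle
    exact hle.trans_eq (mul_right_comm _ _ _)
  rw [integrand_eq_iterIntegrand]
  exact integrable_iterIntegrand (depthRadius_add_mul r) (measurable_kernel c) hdecay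
    (fun k => (isContourFamily_hankelContour hε hεr).isContour (Set.mem_univ (s k)))
    (zero_mem_halfStrip (depthRadius_pos r))

lemma tendsto_iterInt_kernel_div {γ : Fin r → WeightedPath}
    (hγ : ∀ k, IsContour (depthRadius r) (γ k)) :
    Tendsto (fun c : ℝ => iterInt (fun y => kernel c y / (1 - c)) γ 0) (𝓝[≠] 1)
      (𝓝 (iterInt desKernel γ 0)) := by
  obtain ⟨C, hC⟩ := exists_hasExpDecay_kernel_div
  have h0 := zero_mem_halfStrip (depthRadius_pos r)
  refine tendsto_integral_filter_of_dominated_convergence _ ?_ ?_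
    (integrable_iterIntegrand_majorant C hγ) (ae_of_all _ fun u => ?_)
  · exact Eventually.of_forall fun c => (measurable_iterIntegrand
      ((measurable_kernel c).div_const _) (fun k => (hγ k).measurable_path)
      (fun k => (hγ k).measurable_weight) 0).aestronglyMeasurable
  · filter_upwards [eventually_mem_Ioo_and_ne_one] with c ⟨hc, hc1⟩
    exact ae_of_all _ fun u => norm_iterIntegrand_le (depthRadius_add_mul r) (hC c hc hc1)
      (fun k => (hγ k).path_mem) h0 u
  · refine Tendsto.mul_const _ (tendsto_finsetProd _ fun j _ => tendsto_kernel_div ?_)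
    exact halfStrip_subset_strip one_le_two
      (add_tail_sum_mem_halfStrip (depthRadius_add_mul r) h0 (fun k => (hγ k).path_mem (u k)) j)

end NonIntegerExponents

lemma isDesZeta_desZetaInt (r : ℕ) : IsDesZeta r (desZetaInt r) := by
  refine ⟨differentiable_desZetaInt r, ?_⟩
  filter_upwards [Ioc_mem_nhdsGT (depthRadius_pos r)] with ε ⟨hε, hεr⟩ s hs
  refine ⟨eventually_integrable_integrand hε hεr s, ?_⟩
  simp only [preDesZeta_eq_iterInt hs, desZetaInt_eq_iterInt_normHankel hε hεr hs]
  exact tendsto_iterInt_kernel_div fun k => isContour_normHankel hε hεr (s k)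

lemma isDesZeta_desZeta (r : ℕ) : IsDesZeta r (desZeta r) := by
  have hex : ∃ F, IsDesZeta r F := ⟨_, isDesZeta_desZetaInt r⟩
  rw [desZeta, dif_pos hex]
  exact hex.choose_spec

lemma desZeta_eq_desZetaInt (r : ℕ) : desZeta r = desZetaInt r :=
  (isDesZeta_desZeta r).unique (isDesZeta_desZetaInt r)

/-! ### Nonpositive integers -/

lemma hankelCoeff_neg_natCast (n : ℕ) :
    hankelCoeff (-n) = (-1) ^ n * n.factorial / (2 * Real.pi * Complex.I) := by
  have hexp : -(Real.pi * Complex.I * -(n : ℂ)) = n * (Real.pi * Complex.I) := by ring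
  have hGamma : (1 : ℂ) - -(n : ℂ) = n + 1 := by ring
  rw [hankelCoeff, hexp, hGamma, Complex.exp_nat_mul, Complex.exp_pi_mul_I,
    Complex.Gamma_nat_eq_factorial]

lemma exp_two_pi_mul_I_mul_neg_natCast (n : ℕ) :
    Complex.exp (2 * Real.pi * Complex.I * -(n : ℂ)) = 1 := by
  rw [← Complex.exp_int_mul_two_pi_mul_I (-n)]
  push_cast
  ring_nf

lemma circlePart_neg_natCast {ε : ℝ} (hε : 0 < ε) (F : ℂ → ℂ) (n : ℕ) :
    circlePart F (-n) ε = ∮ z in C(0, ε), (1 / (z - 0) ^ (n + 1)) • F z := by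
  rw [circlePart, circleIntegral]
  refine intervalIntegral.integral_congr fun θ _ => ?_
  have hz : Complex.exp (Real.log ε + θ * Complex.I) = circleMap 0 ε θ := by
    rw [circleMap, zero_add, Complex.exp_add, ← Complex.ofReal_exp, Real.exp_log hε]
  have hz0 : circleMap 0 ε θ ≠ 0 := circleMap_ne_center hε.ne'
  have hpow : Complex.exp (-(n : ℂ) * (Real.log ε + θ * Complex.I)) =
      (circleMap 0 ε θ ^ n)⁻¹ := by
    rw [neg_mul, Complex.exp_neg, Complex.exp_nat_mul, hz]
  simp only [logForm, hz, hpow, deriv_circleMap, smul_eq_mul, sub_zero]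
  field_simp
  ring

/- At `s = -n` the contributions of the two half-lines cancel, and Cauchy's formula applies to the
circle. -/
lemma integral_normHankel_neg_natCast {ε ρ : ℝ} (hε : 0 < ε) (hρ : ε < ρ) {f : ℂ → ℂ}
    (hf : IsTestFunction ρ f) (n : ℕ) :
    (normHankel ε (-n)).integral f = (-1) ^ n * iteratedDeriv n f 0 := by
  have hn : (n.factorial : ℂ) ≠ 0 := by exact_mod_cast n.factorial_ne_zero
  have hint := ((isContourFamily_hankelContour hε le_rfl).isContour
    (Set.mem_univ (-(n : ℂ)))).integrable_pullback hρ hf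
  have hball := hf.differentiableOn.mono (closedBall_subset_halfStrip hρ)
  rw [normHankel, WeightedPath.integral_smul, integral_hankelContour hε hint,
    exp_two_pi_mul_I_mul_neg_natCast, sub_self, zero_mul, add_zero, circlePart_neg_natCast hε,
    hball.circleIntegral_one_div_sub_center_pow_smul hε, hankelCoeff_neg_natCast, smul_eq_mul]
  field_simp [Complex.two_pi_I_ne_zero]

section NonposExponents

variable {r : ℕ} {δ ρ : ℝ}

lemma iterInt_normHankel_succ {g : ℂ → ℂ} (hδ : 0 < δ) (hρ : ρ + (r + 1 : ℕ) * δ ≤ 1)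
    (hgm : Measurable g) (hg : IsTestFunction 1 g) {s : Fin (r + 1) → ℂ} {n : ℕ}
    (hn : s (Fin.last r) = -n) {y : ℂ} (hy : y ∈ halfStrip ρ) :
    iterInt g (fun j => normHankel δ (s j)) y =
      (-1) ^ n * iteratedDeriv n
        (fun z => g z * iterInt g (fun j => normHankel δ (Fin.init s j)) z) y := by
  have hγ s : IsContour δ (normHankel δ s) := isContour_normHankel hδ le_rfl s
  have hρ' : (ρ + δ) + r * δ ≤ 1 := by
    push_cast at hρ
    linarith
  obtain ⟨C, hC⟩ := hg.exists_hasExpDecay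
  obtain ⟨ρ', hδρ', htest⟩ := (IsTestFunction.mul_iterInt hρ' hgm hg
    fun j => hγ (Fin.init s j)).exists_comp_const_add hy
  rw [iterInt_succ (integrable_iterIntegrand hρ hgm hC (fun j => hγ (s j)) hy), hn]
  refine (integral_normHankel_neg_natCast hδ hδρ' htest n).trans ?_
  rw [congrFun (iteratedDeriv_comp_const_add n (fun z => g z *
    iterInt g (fun j => normHankel δ (Fin.init s j)) z) y) 0, add_zero]

lemma neg_log_mem_halfStrip {t : ℝ} (hρ : 0 < ρ) (ht : t ∈ Set.Ioo 0 1) :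
    ((-Real.log t : ℝ) : ℂ) ∈ halfStrip ρ := by
  have hlog := Real.log_neg ht.1 ht.2
  refine ⟨?_, ?_⟩
  · rw [Complex.ofReal_re]
    linarith
  · rwa [Complex.ofReal_im, abs_zero]

lemma differentiableOn_iteratedDeriv {U : Set ℂ} (hU : IsOpen U) {f : ℂ → ℂ}
    (hf : DifferentiableOn ℂ f U) (n : ℕ) : DifferentiableOn ℂ (iteratedDeriv n f) U := by
  induction n with
  | zero => rwa [iteratedDeriv_zero]
  | succ n ih =>
    rw [iteratedDeriv_succ]
    exact ih.deriv hU

lemma opD_eq_neg_deriv (hρ : 0 < ρ) {g : ℝ → ℝ} {f : ℂ → ℂ}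
    (hf : DifferentiableOn ℂ f (halfStrip ρ))
    (hg : ∀ t ∈ Set.Ioo (0 : ℝ) 1, (g t : ℂ) = f (-Real.log t : ℝ)) {t : ℝ}
    (ht : t ∈ Set.Ioo (0 : ℝ) 1) : (opD g t : ℂ) = -deriv f (-Real.log t : ℝ) := by
  have hf' : HasDerivAt f (deriv f (-Real.log t : ℝ)) (-Real.log t : ℝ) :=
    (hf.differentiableAt ((isOpen_halfStrip ρ).mem_nhds (neg_log_mem_halfStrip hρ ht))).hasDerivAt
  have hlog : HasDerivAt (fun t : ℝ => ((-Real.log t : ℝ) : ℂ)) (-t⁻¹ : ℝ) t :=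
    (Real.hasDerivAt_log ht.1.ne').neg.ofReal_comp
  have hcomp : HasDerivAt (fun t : ℝ => (g t : ℂ))
      (deriv f (-Real.log t : ℝ) * (-t⁻¹ : ℝ)) t := by
    refine (hf'.comp t hlog).congr_of_eventuallyEq ?_
    filter_upwards [Ioo_mem_nhds ht.1 ht.2] with x hx using hg x hx
  have hre : HasDerivAt g (deriv f (-Real.log t : ℝ) * (-t⁻¹ : ℝ)).re t := by
    simpa using! Complex.reCLM.hasFDerivAt.comp_hasDerivAt t hcomp
  have ht0 : (t : ℂ) ≠ 0 := Complex.ofReal_ne_zero.2 ht.1.ne'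
  rw [opD, hre.deriv, Complex.ofReal_mul, hre.ofReal_comp.unique hcomp]
  push_cast
  field_simp

lemma iterate_opD_eq_iteratedDeriv (hρ : 0 < ρ) {g : ℝ → ℝ} {f : ℂ → ℂ}
    (hf : DifferentiableOn ℂ f (halfStrip ρ))
    (hg : ∀ t ∈ Set.Ioo (0 : ℝ) 1, (g t : ℂ) = f (-Real.log t : ℝ)) (n : ℕ) {t : ℝ}
    (ht : t ∈ Set.Ioo (0 : ℝ) 1) :
    (opD^[n] g t : ℂ) = (-1) ^ n * iteratedDeriv n f (-Real.log t : ℝ) := by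
  induction n generalizing t with
  | zero => simpa using hg t ht
  | succ n ih =>
    have hd := differentiableOn_iteratedDeriv (isOpen_halfStrip ρ) hf n
    rw [Function.iterate_succ_apply', opD_eq_neg_deriv hρ (hd.const_mul ((-1) ^ n))
      (fun _ => ih) ht, iteratedDeriv_succ, deriv_const_mul_field]
    ring

lemma opJPow_neg_natCast (n : ℕ) : opJPow (-n) = opD^[n] := by
  cases n <;> rfl

lemma desLiZero_eq_desKernel {t : ℝ} (ht : t ∈ Set.Ioo (0 : ℝ) 1) :
    (desLiZero t : ℂ) = desKernel (-Real.log t : ℝ) := by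
  have hlog : ((-Real.log t : ℝ) : ℂ) ≠ 0 :=
    Complex.ofReal_ne_zero.2 (neg_pos.2 (Real.log_neg ht.1 ht.2)).ne'
  have ht0 : (t : ℂ) ≠ 0 := Complex.ofReal_ne_zero.2 ht.1.ne'
  have ht1 : 1 - (t : ℂ) ≠ 0 := sub_ne_zero.2 (by exact_mod_cast ht.2.ne')
  have hexp : Complex.exp (-Real.log t : ℝ) = (t : ℂ)⁻¹ := by
    rw [← Complex.ofReal_exp, Real.exp_neg, Real.exp_log ht.1, Complex.ofReal_inv]
  have hsub : (t : ℂ)⁻¹ - 1 = (1 - t) / t := by field_simp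
  rw [desKernel_of_ne_zero (halfStrip_subset_strip one_le_two (neg_log_mem_halfStrip one_pos ht))
    hlog, hexp, hsub, desLiZero]
  push_cast
  field_simp
  ring

lemma desLi_eq_iterInt (hδ : 0 < δ) (hρ0 : 0 < ρ) (hρ : ρ + r * δ ≤ 1) {k : Fin r → ℤ}
    (hk : ∀ j, k j ≤ 0) {t : ℝ} (ht : t ∈ Set.Ioo (0 : ℝ) 1) :
    (desLi r k t : ℂ) = iterInt desKernel (fun j => normHankel δ (k j)) (-Real.log t : ℝ) := by
  induction r generalizing ρ t with
  | zero => simp [desLi, iterInt_zero]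
  | succ r ih =>
    obtain ⟨n, hn⟩ := Int.exists_eq_neg_ofNat (hk (Fin.last r))
    have hρ' : (ρ + δ) + r * δ ≤ 1 := by
      push_cast at hρ
      linarith
    have htest := IsTestFunction.mul_iterInt hρ' measurable_desKernel isTestFunction_desKernel
      fun j => isContour_normHankel hδ le_rfl (Fin.init k j : ℤ)
    have hlast : ((k (Fin.last r) : ℤ) : ℂ) = -n := by
      rw [hn]
      push_cast
      rfl
    rw [iterInt_normHankel_succ hδ hρ measurable_desKernel isTestFunction_desKernel
      (s := fun j => (k j : ℂ)) hlast (neg_log_mem_halfStrip hρ0 ht), desLi, hn,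
      opJPow_neg_natCast]
    refine iterate_opD_eq_iteratedDeriv (by linarith) htest.differentiableOn (fun x hx => ?_) n ht
    rw [Complex.ofReal_mul, desLiZero_eq_desKernel hx,
      ih (by linarith) hρ' (k := Fin.init k) (fun j => hk j.castSucc) hx]

lemma desZetaInt_intCast_of_nonpos {k : Fin r → ℤ} (hk : ∀ j, k j ≤ 0) :
    desZetaInt r (fun j => (k j : ℂ)) =
      iterInt desKernel (fun j => normHankel (depthRadius r) (k j)) 0 := by
  have hcontour j : desContour (depthRadius r) (k j) = normHankel (depthRadius r) (k j) := by
    have hre : (k j : ℝ) ≤ 0 := by exact_mod_cast hk j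
    refine if_neg ?_
    rw [Complex.intCast_re]
    linarith
  simp only [desZetaInt, hcontour]

lemma tendsto_desLi {k : Fin r → ℤ} (hk : ∀ j, k j ≤ 0) :
    Tendsto (fun t : ℝ => (desLi r k t : ℂ)) (𝓝[<] 1) (𝓝 (desZetaInt r fun j => (k j : ℂ))) := by
  have hδ := depthRadius_pos r
  have hcont := (differentiableOn_iterInt (depthRadius_add_mul r) measurable_desKernel
    isTestFunction_desKernel fun j => isContour_normHankel hδ le_rfl (k j)).continuousOn
      |>.continuousAt ((isOpen_halfStrip _).mem_nhds (zero_mem_halfStrip hδ))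
  have hlog : Tendsto (fun t : ℝ => ((-Real.log t : ℝ) : ℂ)) (𝓝[<] 1) (𝓝 0) := by
    have hlog' : ContinuousAt (fun t : ℝ => ((-Real.log t : ℝ) : ℂ)) 1 :=
      Complex.continuous_ofReal.continuousAt.comp (Real.continuousAt_log one_ne_zero).neg
    simpa using hlog'.tendsto.mono_left nhdsWithin_le_nhds
  rw [desZetaInt_intCast_of_nonpos hk]
  refine (hcont.tendsto.comp hlog).congr' ?_
  filter_upwards [Ioo_mem_nhdsLT one_pos] with t ht
  exact (desLi_eq_iterInt hδ hδ (depthRadius_add_mul r) hk ht).symm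

end NonposExponents

end DesMZF

end

theorem mainTheorem10 (r : ℕ) (hr : 1 ≤ r) :
    DesMZF.IsDesZeta r (DesMZF.desZeta r) ∧
      ∀ k : Fin r → ℤ, (∀ j, k j ≤ 0) →
        Tendsto (fun t : ℝ => (DesMZF.desLi r k t : ℂ)) (𝓝[<] 1)
          (𝓝 (DesMZF.desZeta r (fun j => (k j : ℂ)))) := by
  rw [DesMZF.desZeta_eq_desZetaInt]
  exact ⟨DesMZF.isDesZeta_desZetaInt r, fun _ hk => DesMZF.tendsto_desLi hk⟩
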